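/- Let $(M,g)$ be a $(d+1)$-dimensional time-oriented, globally hyperbolic Lorentzian manifold with $g\in C^1$, and let $\iota:M\hookrightarrow\tilde M$ be a $C^{0,1}_{\mathrm{loc}}$-extension, i.e. a smooth isometric embedding into a Lorentzian manifold $(\tilde M,\tilde g)$ of the same dimension with $\tilde g\in C^{0,1}_{\mathrm{loc}}$ and $\partial\iota(M)\neq\emptyset$. The future boundary $\partial^+\iota(M)$ is the set of points $\tilde p\in\partial\iota(M)$ for which there is a smooth timelike curve $\tilde\gamma:[-1,0]\to\tilde M$ with $\tilde\gamma(0)=\tilde p$, $\tilde\gamma([-1,0))\subseteq\iota(M)$ and $\iota^{-1}\circ\tilde\gamma|_{[-1,0)}$ future directed in $M$. Let $\tilde p\in\partial^+\iota(M)$, let $\delta>0$, let $\Sigma$ be a Cauchy hypersurface of $M$, and let $\tilde\varphi:\tilde U\to(-\varepsilon_0,\varepsilon_0)\times(-\varepsilon_1,\varepsilon_1)^d$ be a future boundary chart around $\tilde p$, that is: $\tilde\varphi(\tilde p)=0$; $|\tilde g_{\mu\nu}-m_{\mu\nu}|<\delta$ in $\tilde U$, where $m=\mathrm{diag}(-1,1,\dots,1)$;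 and there is a Lipschitz function $f:(-\varepsilon_1,\varepsilon_1)^d\to(-\varepsilon_0,\varepsilon_0)$ such that $\tilde U_<:=\{(x_0,\underline x)\in\tilde U: x_0<f(\underline x)\}\subseteq\iota(I^+(\Sigma,M))$, and $\mathrm{graph}(f)=\{x_0=f(\underline x)\}\subseteq\partial^+\iota(M)$ is achronal in $\tilde U$ (no smooth timelike curve in $\tilde U$ starts and ends on it). Let $\tilde\gamma_1,\tilde\gamma_2:[-1,0)\to\tilde U_<$ be two future directed causal $C^1$-curves (with respect to the time orientation of $M$) such that $$\lim_{s\to0}\tilde\gamma_1(s)=\lim_{s\to0}\tilde\gamma_2(s)\in\mathrm{graph}(f).$$ For a piecewise $C^1$-curve $\gamma:I\to\tilde U_<$ and an orthonormal frame field $\{e_\alpha(s)\}_{\alpha=0}^d$ that is parallel along $\gamma$, the gap-length is $L_{\mathrm{gap},e_\alpha}(\gamma)=\int_I\big(\sum_\alpha(\dot\gamma^\alpha(s))^2\big)^{1/2}ds$, where $\dot\gamma(s)=\sum_\alpha\dot\gamma^\alpha(s)e_\alpha(s)$. Then: 1. For $i=1,2$, parallel orthonormal frame fields along $\tilde\gamma_i$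 exist, and $\tilde\gamma_i$ has finite gap-length with respect to each of them. 2. There exist sequences $s_n,t_n\in[-1,0)$ with $s_n\to0$ and $t_n\to0$, and piecewise $C^1$-curves $\tilde\sigma_n:[0,1]\to\tilde U_<$ from $\tilde\gamma_1(s_n)$ to $\tilde\gamma_2(t_n)$, such that for all parallel orthonormal frame fields $\tilde e^{(i)}_\alpha$ along $\tilde\gamma_i$, $i=1,2$, the following holds. The frame $\tilde e^{(1)}_\alpha|_{\tilde\gamma_1(s_n)}$ can be parallelly propagated along $\tilde\sigma_n$; with respect to the resulting frame field (again denoted $\tilde e^{(1)}_\alpha$), $L_{\mathrm{gap},\tilde e^{(1)}_\alpha}(\tilde\sigma_n)\to0$ as $n\to\infty$; and the Lorentz transformations $L_n$ defined by $\tilde e^{(1)}_\alpha|_{\tilde\sigma_n(1)}=\sum_\beta (L_n)_\alpha{}^{\beta}\,\tilde e^{(2)}_\beta|_{\tilde\gamma_2(t_n)}$ are bounded in operator norm uniformly in $n$. -/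

import Mathlib

open Set Filter Topology MeasureTheory
open scoped Manifold ContDiff ENNReal

noncomputable section

/-- The coordinate space `ℝ^{d+1}` with coordinates `x 0, x 1, …, x d`; `x 0` is the time
coordinate. It is the model space of all `(d+1)`-dimensional manifolds below. -/
abbrev Coord (d : ℕ) : Type := EuclideanSpace ℝ (Fin (d + 1))

/-- The Minkowski matrix `diag(-1, 1, …, 1)`. -/
def minkowskiMatrix (d : ℕ) : Matrix (Fin (d + 1)) (Fin (d + 1)) ℝ :=
  Matrix.diagonal (fun μ => if μ = 0 then -1 else 1)

/-- `L` is a Lorentz transformation: it preserves the Minkowski form. -/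
def IsLorentzMatrix (d : ℕ) (L : Matrix (Fin (d + 1)) (Fin (d + 1)) ℝ) : Prop :=
  L * minkowskiMatrix d * L.transpose = minkowskiMatrix d

section Metric

variable {d : ℕ} {M : Type*} [TopologicalSpace M] [ChartedSpace (Coord d) M]

/-- A field of symmetric bilinear forms of signature `(-,+,…,+)` on the tangent spaces. Its
regularity is a separate condition, see `IsC1` and `IsLocallyLipschitz`. -/
structure LorentzianMetric (d : ℕ) (M : Type*) [TopologicalSpace M]
    [ChartedSpace (Coord d) M] where
  /-- the bilinear form on each tangent space -/
  form : ∀ x : M, LinearMap.BilinForm ℝ (TangentSpace (𝓡 (d + 1)) x)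
  symm : ∀ x v w, form x v w = form x w v
  exists_orthonormal : ∀ x, ∃ b : Module.Basis (Fin (d + 1)) ℝ (TangentSpace (𝓡 (d + 1)) x),
    ∀ α β, form x (b α) (b β) = minkowskiMatrix d α β

/-- The chart `e` belongs to the smooth structure of `M`. -/
def IsSmoothChart (e : OpenPartialHomeomorph M (Coord d)) : Prop :=
  e ∈ IsManifold.maximalAtlas (𝓡 (d + 1)) ∞ M

/-- The coordinate vector field `∂_μ` of the chart `e` at the point with coordinates `y`. -/
def coordVec (e : OpenPartialHomeomorph M (Coord d)) (μ : Fin (d + 1)) (y : Coord d) :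
    TangentSpace (𝓡 (d + 1)) (e.symm y) :=
  mfderiv (𝓡 (d + 1)) (𝓡 (d + 1)) e.symm y (EuclideanSpace.single μ (1 : ℝ) : Coord d)

/-- The coordinate components of a tangent vector `v` at `x` in the chart `e`. -/
def inCoord (e : OpenPartialHomeomorph M (Coord d)) (x : M)
    (v : TangentSpace (𝓡 (d + 1)) x) : Coord d :=
  mfderiv (𝓡 (d + 1)) (𝓡 (d + 1)) e x v

namespace LorentzianMetric

/-- The component `g_{μν}` in the chart `e`, as a function of the coordinates. -/
def coeff (g : LorentzianMetric d M) (e : OpenPartialHomeomorph M (Coord d))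
    (μ ν : Fin (d + 1)) (y : Coord d) : ℝ :=
  g.form (e.symm y) (coordVec e μ y) (coordVec e ν y)

/-- The metric is continuously differentiable. -/
def IsC1 (g : LorentzianMetric d M) : Prop :=
  ∀ e : OpenPartialHomeomorph M (Coord d), IsSmoothChart e →
    ∀ μ ν, ContDiffOn ℝ 1 (g.coeff e μ ν) e.target

/-- The metric is of class `C^{0,1}_loc`. -/
def IsLocallyLipschitz (g : LorentzianMetric d M) : Prop :=
  ∀ e : OpenPartialHomeomorph M (Coord d), IsSmoothChart e →
    ∀ μ ν, LocallyLipschitzOn e.target (g.coeff e μ ν)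

/-- The partial derivative `∂_κ g_{μν}` in the chart `e`. -/
def dCoeff (g : LorentzianMetric d M) (e : OpenPartialHomeomorph M (Coord d))
    (κ μ ν : Fin (d + 1)) (y : Coord d) : ℝ :=
  fderiv ℝ (g.coeff e μ ν) y (EuclideanSpace.single κ (1 : ℝ))

/-- The Christoffel symbol `Γ^μ_{ρσ}` of the Levi-Civita connection in the chart `e`. It is
meaningful at points near which the metric is continuously differentiable. -/
def christoffel (g : LorentzianMetric d M) (e : OpenPartialHomeomorph M (Coord d))
    (μ ρ σ : Fin (d + 1)) (y : Coord d) : ℝ :=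
  (1 / 2 : ℝ) * ∑ ν, ((Matrix.of fun a b => g.coeff e a b y)⁻¹ : Matrix _ _ ℝ) μ ν *
    (g.dCoeff e ρ ν σ y + g.dCoeff e σ ν ρ y - g.dCoeff e ν ρ σ y)

def IsTimelike (g : LorentzianMetric d M) (x : M) (v : TangentSpace (𝓡 (d + 1)) x) : Prop :=
  g.form x v v < 0

def IsCausal (g : LorentzianMetric d M) (x : M) (v : TangentSpace (𝓡 (d + 1)) x) : Prop :=
  g.form x v v ≤ 0 ∧ v ≠ 0

/-- A time orientation, given by a continuous timelike vector field. -/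
structure IsTimeOrientation [IsManifold (𝓡 (d + 1)) ∞ M] (g : LorentzianMetric d M)
    (T : ∀ x : M, TangentSpace (𝓡 (d + 1)) x) : Prop where
  continuous : Continuous fun x => (⟨x, T x⟩ : TangentBundle (𝓡 (d + 1)) M)
  timelike : ∀ x, g.IsTimelike x (T x)

end LorentzianMetric

/-- The velocity at time `t` of a curve defined on `S` (one-sided at end points of `S`). -/
def velocity (d : ℕ) {M : Type*} [TopologicalSpace M] [ChartedSpace (Coord d) M]
    (γ : ℝ → M) (S : Set ℝ) (t : ℝ) : TangentSpace (𝓡 (d + 1)) (γ t) :=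
  mfderivWithin 𝓘(ℝ) (𝓡 (d + 1)) γ S t (1 : ℝ)

namespace LorentzianMetric

/-- A smooth timelike curve on `S`; its velocity is timelike at every time in `S`. -/
def IsSmoothTimelikeCurve (g : LorentzianMetric d M) (γ : ℝ → M) (S : Set ℝ) : Prop :=
  ContMDiffOn 𝓘(ℝ) (𝓡 (d + 1)) ∞ γ S ∧ ∀ t ∈ S, g.IsTimelike (γ t) (velocity d γ S t)

/-- A smooth future directed timelike curve on `S`. -/
def IsFutureTimelikeCurve (g : LorentzianMetric d M) (T : ∀ x : M, TangentSpace (𝓡 (d + 1)) x)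
    (γ : ℝ → M) (S : Set ℝ) : Prop :=
  g.IsSmoothTimelikeCurve γ S ∧ ∀ t ∈ S, g.form (γ t) (T (γ t)) (velocity d γ S t) < 0

/-- A future directed causal `C^1`-curve on `S`. -/
def IsFutureCausalC1Curve (g : LorentzianMetric d M) (T : ∀ x : M, TangentSpace (𝓡 (d + 1)) x)
    (γ : ℝ → M) (S : Set ℝ) : Prop :=
  ContMDiffOn 𝓘(ℝ) (𝓡 (d + 1)) 1 γ S ∧ ∀ t ∈ S, g.IsCausal (γ t) (velocity d γ S t) ∧
    g.form (γ t) (T (γ t)) (velocity d γ S t) < 0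

/-- The timelike future `I⁺(A, M)`. -/
def timelikeFuture (g : LorentzianMetric d M) (T : ∀ x : M, TangentSpace (𝓡 (d + 1)) x)
    (A : Set M) : Set M :=
  {q | ∃ γ : ℝ → M, g.IsFutureTimelikeCurve T γ (Icc 0 1) ∧ γ 0 ∈ A ∧ γ 1 = q}

/-- A Cauchy hypersurface: a set met exactly once by every inextendible timelike curve. An
inextendible curve has an open interval as its domain, which we parametrise by `ℝ`. -/
def IsCauchyHypersurface (g : LorentzianMetric d M) (A : Set M) : Prop :=
  ∀ γ : ℝ → M, g.IsSmoothTimelikeCurve γ univ →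
    (¬ ∃ q, Tendsto γ atTop (𝓝 q)) → (¬ ∃ q, Tendsto γ atBot (𝓝 q)) → ∃! t, γ t ∈ A

def IsGloballyHyperbolic (g : LorentzianMetric d M) : Prop :=
  ∃ A, g.IsCauchyHypersurface A

end LorentzianMetric

/-! ### Parallel frames and gap-length -/

/-- A basis of the tangent space at every point of the curve `γ`. -/
abbrev FrameAlong (d : ℕ) {M : Type*} [TopologicalSpace M] [ChartedSpace (Coord d) M]
    (γ : ℝ → M) : Type :=
  ∀ t : ℝ, Module.Basis (Fin (d + 1)) ℝ (TangentSpace (𝓡 (d + 1)) (γ t))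

namespace LorentzianMetric

/-- `X` is parallel along the `C^1`-curve `γ` on `S`: in every chart it satisfies
`dX^μ/ds + Γ^μ_{ρσ} (γ')^ρ X^σ = 0`. -/
def IsParallel (g : LorentzianMetric d M) (γ : ℝ → M) (S : Set ℝ)
    (X : ∀ t : ℝ, TangentSpace (𝓡 (d + 1)) (γ t)) : Prop :=
  ∀ e : OpenPartialHomeomorph M (Coord d), IsSmoothChart e → ∀ t ∈ S, γ t ∈ e.source →
    HasDerivWithinAt (fun s => inCoord e (γ s) (X s))
      (WithLp.toLp 2 fun μ => -∑ ρ, ∑ σ, g.christoffel e μ ρ σ (e (γ t)) *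
        inCoord e (γ t) (velocity d γ S t) ρ * inCoord e (γ t) (X t) σ) S t

/-- A parallel orthonormal frame field along the `C^1`-curve `γ` on `S`. -/
def IsParallelFrame (g : LorentzianMetric d M) (γ : ℝ → M) (S : Set ℝ)
    (E : FrameAlong d γ) : Prop :=
  (∀ t ∈ S, ∀ α β, g.form (γ t) (E t α) (E t β) = minkowskiMatrix d α β) ∧
    ∀ α, g.IsParallel γ S fun t => E t α

end LorentzianMetric

/-- `γ` is `C^1` on each interval of a subdivision `p 0 < p 1 < … < p N` of `[a, b]`. -/
def IsC1Subdivision (d : ℕ) {M : Type*} [TopologicalSpace M] [ChartedSpace (Coord d) M]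
    (γ : ℝ → M) (a b : ℝ) (N : ℕ) (p : ℕ → ℝ) : Prop :=
  p 0 = a ∧ p N = b ∧ ∀ i < N, p i < p (i + 1) ∧
    ContMDiffOn 𝓘(ℝ) (𝓡 (d + 1)) 1 γ (Icc (p i) (p (i + 1)))

/-- A piecewise `C^1`-curve on `[a, b]` (in particular continuous if `a < b`). -/
def IsPiecewiseC1 (d : ℕ) {M : Type*} [TopologicalSpace M] [ChartedSpace (Coord d) M]
    (γ : ℝ → M) (a b : ℝ) : Prop :=
  ∃ N p, IsC1Subdivision d γ a b N p

/-- A parallel orthonormal frame field along a piecewise `C^1`-curve on `[a, b]`: it is parallel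
on each closed piece, hence continuous at the break points. -/
def LorentzianMetric.IsPiecewiseParallelFrame (g : LorentzianMetric d M) (γ : ℝ → M) (a b : ℝ)
    (E : FrameAlong d γ) : Prop :=
  ∃ N p, IsC1Subdivision d γ a b N p ∧
    ∀ i < N, g.IsParallelFrame γ (Icc (p i) (p (i + 1))) E

/-- The gap-length `∫_S (∑_α (γ'^α)²)^{1/2} ds` of `γ` on `S`, where `γ' = γ'^α E_α`. -/
def gapLength (d : ℕ) {M : Type*} [TopologicalSpace M] [ChartedSpace (Coord d) M]
    (γ : ℝ → M) (S : Set ℝ) (E : FrameAlong d γ) : ℝ≥0∞ :=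
  ∫⁻ t in S, ENNReal.ofReal (√(∑ α, ((E t).repr (velocity d γ S t) α) ^ 2))

/-- `γ` has finite gap-length on `S`: it carries parallel orthonormal frame fields, and the
gap-length with respect to each of them is finite. -/
def LorentzianMetric.HasFiniteGapLength (g : LorentzianMetric d M) (γ : ℝ → M) (S : Set ℝ) :
    Prop :=
  (∃ E : FrameAlong d γ, g.IsParallelFrame γ S E) ∧
    ∀ E : FrameAlong d γ, g.IsParallelFrame γ S E → gapLength d γ S E < ⊤

end Metric

/-! ### Extensions, the future boundary and boundary charts -/

section Extension

variable {d : ℕ} {M M' : Type*} [TopologicalSpace M] [ChartedSpace (Coord d) M]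
  [TopologicalSpace M'] [ChartedSpace (Coord d) M']

/-- `ι` is a `C^{0,1}_loc`-extension of `(M, g)` into `(M', g')`. The dimensions agree since both
manifolds are modelled on `Coord d`. -/
structure IsLipschitzExtension (g : LorentzianMetric d M) (g' : LorentzianMetric d M')
    (ι : M → M') : Prop where
  embedding : Manifold.IsSmoothEmbedding (𝓡 (d + 1)) (𝓡 (d + 1)) ∞ ι
  isometric : ∀ x (v w : TangentSpace (𝓡 (d + 1)) x),
    g'.form (ι x) (mfderiv (𝓡 (d + 1)) (𝓡 (d + 1)) ι x v)
      (mfderiv (𝓡 (d + 1)) (𝓡 (d + 1)) ι x w) = g.form x v w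
  regular : g'.IsLocallyLipschitz
  boundary_nonempty : (frontier (range ι)).Nonempty

/-- The future boundary `∂⁺ι(M)`. -/
def futureBoundary (g : LorentzianMetric d M) (T : ∀ x : M, TangentSpace (𝓡 (d + 1)) x)
    (g' : LorentzianMetric d M') (ι : M → M') : Set M' :=
  {p | p ∈ frontier (range ι) ∧ ∃ c : ℝ → M', g'.IsSmoothTimelikeCurve c (Icc (-1) 0) ∧ c 0 = p ∧
    ∃ γ : ℝ → M, (∀ t ∈ Ico (-1 : ℝ) 0, ι (γ t) = c t) ∧ g.IsFutureTimelikeCurve T γ (Ico (-1) 0)}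

/-- The spatial coordinates `(x 1, …, x d)`. -/
def spatialPart {d : ℕ} (y : Coord d) : EuclideanSpace ℝ (Fin d) :=
  WithLp.toLp 2 fun i => y i.succ

/-- The cube `(-ε, ε)^d`. -/
def openCube (d : ℕ) (ε : ℝ) : Set (EuclideanSpace ℝ (Fin d)) :=
  {z | ∀ i, z i ∈ Ioo (-ε) ε}

/-- The points of the chart domain below the graph of `f`. -/
def belowGraph (φ : OpenPartialHomeomorph M' (Coord d)) (f : EuclideanSpace ℝ (Fin d) → ℝ) :
    Set M' :=
  {x | x ∈ φ.source ∧ φ x 0 < f (spatialPart (φ x))}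

/-- The points of the chart domain on the graph of `f`. -/
def onGraph (φ : OpenPartialHomeomorph M' (Coord d)) (f : EuclideanSpace ℝ (Fin d) → ℝ) :
    Set M' :=
  {x | x ∈ φ.source ∧ φ x 0 = f (spatialPart (φ x))}

/-- `φ` is a future boundary chart around `p`, with domain mapped onto
`(-ε₀, ε₀) × (-ε₁, ε₁)^d`, metric components `δ`-close to Minkowski, and Lipschitz graphing
function `f`; `A` is a Cauchy hypersurface of `M`. -/
structure IsFutureBoundaryChart (g : LorentzianMetric d M)
    (T : ∀ x : M, TangentSpace (𝓡 (d + 1)) x) (g' : LorentzianMetric d M') (ι : M → M')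
    (A : Set M) (p : M') (δ ε₀ ε₁ : ℝ) (φ : OpenPartialHomeomorph M' (Coord d))
    (f : EuclideanSpace ℝ (Fin d) → ℝ) : Prop where
  smooth : IsSmoothChart φ
  ε₀_pos : 0 < ε₀
  ε₁_pos : 0 < ε₁
  target_eq : φ.target = {y | y 0 ∈ Ioo (-ε₀) ε₀ ∧ spatialPart y ∈ openCube d ε₁}
  mem_source : p ∈ φ.source
  map_center : φ p = 0
  near_minkowski : ∀ y ∈ φ.target, ∀ μ ν, |g'.coeff φ μ ν y - minkowskiMatrix d μ ν| < δ
  lipschitz : ∃ C, LipschitzOnWith C f (openCube d ε₁)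
  maps_to : MapsTo f (openCube d ε₁) (Ioo (-ε₀) ε₀)
  below_subset : belowGraph φ f ⊆ ι '' g.timelikeFuture T A
  graph_subset : onGraph φ f ⊆ futureBoundary g T g' ι
  achronal : ¬ ∃ c : ℝ → M', g'.IsSmoothTimelikeCurve c (Icc 0 1) ∧
    MapsTo c (Icc 0 1) φ.source ∧ c 0 ∈ onGraph φ f ∧ c 1 ∈ onGraph φ f

end Extension

end

/-!
The whole argument takes place in the boundary chart `φ`, near the common end point `q` of the two
curves. The isometric embedding is a local diffeomorphism, so the components of `g'` are `C¹` at all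
points below the graph (`contDiffAt_coeff_of_isometric`); hence the Christoffel symbols are
continuous there and the parallel transport equation is a linear ordinary differential equation with
continuous coefficients, solvable along every `C¹` curve below the graph (`exists_parallelFrame`).
What makes the estimates uniform up to the boundary is that `g'` is Lipschitz at `q`: the Christoffel
symbols stay bounded as the graph is approached (`exists_eventually_norm_christoffelMap_le`),
although they need not have a limit there.

*Finite gap-length.* At points near `q`, every causal vector is controlled by its time component
`τ` with respect to a basis which is orthonormal at `q`. Along a causal curve `τ` of the velocity
therefore never vanishes, so it has a fixed sign, and `τ` of the curve itself is a bounded clock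
whose rate dominates the coordinate speed (`exists_clock`). This bounds the length of the curve and,
since the logarithmic growth rate of a parallel field is at most the Christoffel bound times the
speed, also the components of parallel frames (`exists_bounds_near_end`). The components of the
velocity in an orthonormal frame are products with the frame vectors, so the gap-length is bounded
by the coordinate length (`sqrt_sum_repr_sq_le`).

*Comparison.* Two points below the graph of the Lipschitz function `f` and at distance at most `r`
from `q` are joined below the graph by a smooth curve of length `O(r)`: the chord, pushed down by a
parabola whose height is a multiple of the length of the chord (`exists_connecting_curve`). Taking
`r → 0`, the transported frames remain bounded along these curves, and their gap-length tends to
zero. The entries of the Lorentz transformation comparing two orthonormal frames are, up to sign,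
the mutual products of the frame vectors, hence are bounded when both frames are.

Parallelism is required in every chart; it is enough to verify it in `φ`, by the transformation law
of the Christoffel symbols (`christoffelMap_transition`, `isParallel_of_chart`).
-/

noncomputable section

/-! ### Linear ordinary differential equations on an interval -/

/-- A linear differential inequality bounds the growth of a solution; the function `τ` plays the
role of an integral of the coefficient. -/
theorem norm_le_exp_mul_norm {F : Type*} [NormedAddCommGroup F] [InnerProductSpace ℝ F]
    {S : Set ℝ} (hS : Convex ℝ S) {X X' : ℝ → F} {τ τ' : ℝ → ℝ}
    (hX : ∀ t ∈ S, HasDerivWithinAt X (X' t) S t)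
    (hτ : ∀ t ∈ S, HasDerivWithinAt τ (τ' t) S t)
    (hle : ∀ t ∈ S, ‖X' t‖ ≤ τ' t * ‖X t‖) {s t : ℝ} (hs : s ∈ S) (ht : t ∈ S) (hst : s ≤ t) :
    ‖X t‖ ≤ Real.exp (τ t - τ s) * ‖X s‖ := by
  have hder : ∀ r ∈ S, HasDerivWithinAt (fun r => Real.exp (-2 * τ r) * ‖X r‖ ^ 2)
      (Real.exp (-2 * τ r) * (-2 * τ' r) * ‖X r‖ ^ 2 +
        Real.exp (-2 * τ r) * (2 * inner ℝ (X r) (X' r))) S r := fun r hr =>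
    (((hτ r hr).const_mul (-2)).exp).mul (hX r hr).norm_sq
  have hanti : AntitoneOn (fun r => Real.exp (-2 * τ r) * ‖X r‖ ^ 2) S := by
    refine antitoneOn_of_hasDerivWithinAt_nonpos hS
      (fun r hr => (hder r hr).continuousWithinAt)
      (fun r hr => (hder r (interior_subset hr)).mono interior_subset) fun r hr => ?_
    have hr' := interior_subset hr
    have h1 : inner ℝ (X r) (X' r) ≤ τ' r * ‖X r‖ ^ 2 := by
      refine (real_inner_le_norm _ _).trans ?_
      have := mul_le_mul_of_nonneg_left (hle r hr') (norm_nonneg (X r))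
      nlinarith
    have h2 := mul_le_mul_of_nonneg_left h1 (Real.exp_pos (-2 * τ r)).le
    nlinarith
  have h := hanti hs ht hst
  simp only at h
  have h3 : ‖X t‖ ^ 2 ≤ (Real.exp (τ t - τ s) * ‖X s‖) ^ 2 := by
    have e1 : Real.exp (-2 * τ t) * Real.exp (2 * τ t) = 1 := by
      rw [← Real.exp_add]; simp
    have e2 : Real.exp (-2 * τ s) * Real.exp (2 * τ t) = Real.exp (τ t - τ s) ^ 2 := by
      rw [← Real.exp_add, ← Real.exp_nat_mul]; congr 1; push_cast; ring
    calc ‖X t‖ ^ 2 = (Real.exp (-2 * τ t) * ‖X t‖ ^ 2) * Real.exp (2 * τ t) := by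
          rw [mul_right_comm, e1, one_mul]
      _ ≤ (Real.exp (-2 * τ s) * ‖X s‖ ^ 2) * Real.exp (2 * τ t) := by gcongr
      _ = (Real.exp (τ t - τ s) * ‖X s‖) ^ 2 := by rw [mul_right_comm, e2, mul_pow]
  exact le_of_sq_le_sq h3 (by positivity)

section Cutoff

variable {F : Type*} [NormedAddCommGroup F] [NormedSpace ℝ F]

/-- The radial retraction onto the ball of radius `R`, used to cut off a linear vector field. -/
def radialCutoff (R : ℝ) (x : F) : F := (R / max R ‖x‖) • x

theorem norm_radialCutoff_le_norm {R : ℝ} (hR : 0 < R) (x : F) : ‖radialCutoff R x‖ ≤ ‖x‖ := by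
  have hm : 0 < max R ‖x‖ := lt_max_of_lt_left hR
  rw [radialCutoff, norm_smul, Real.norm_of_nonneg (by positivity)]
  exact mul_le_of_le_one_left (norm_nonneg x) ((div_le_one hm).2 (le_max_left _ _))

theorem norm_radialCutoff_le {R : ℝ} (hR : 0 < R) (x : F) : ‖radialCutoff R x‖ ≤ R := by
  have hm : 0 < max R ‖x‖ := lt_max_of_lt_left hR
  rw [radialCutoff, norm_smul, Real.norm_of_nonneg (by positivity), div_mul_eq_mul_div,
    div_le_iff₀ hm]
  exact mul_le_mul_of_nonneg_left (le_max_right _ _) hR.le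

theorem radialCutoff_of_norm_le {R : ℝ} (hR : 0 < R) {x : F} (hx : ‖x‖ ≤ R) :
    radialCutoff R x = x := by
  rw [radialCutoff, max_eq_left hx, div_self hR.ne', one_smul]

theorem lipschitzWith_radialCutoff {R : ℝ} (hR : 0 < R) :
    LipschitzWith 2 (radialCutoff R : F → F) := by
  refine LipschitzWith.of_dist_le_mul fun x y => ?_
  have hx : 0 < max R ‖x‖ := lt_max_of_lt_left hR
  have hy : 0 < max R ‖y‖ := lt_max_of_lt_left hR
  have key : radialCutoff R x - radialCutoff R y =
      (R / max R ‖x‖) • (x - y) +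
        ((R / max R ‖x‖) * ((max R ‖y‖ - max R ‖x‖) / max R ‖y‖)) • y := by
    have : R / max R ‖x‖ * ((max R ‖y‖ - max R ‖x‖) / max R ‖y‖) =
        R / max R ‖x‖ - R / max R ‖y‖ := by field_simp
    rw [this, radialCutoff, radialCutoff]
    module
  have h1 : R / max R ‖x‖ ≤ 1 := (div_le_one hx).2 (le_max_left _ _)
  have h0 : 0 ≤ R / max R ‖x‖ := by positivity
  have h2 : |max R ‖y‖ - max R ‖x‖| ≤ ‖x - y‖ := by
    refine (abs_max_sub_max_le_max R ‖y‖ R ‖x‖).trans ?_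
    rw [sub_self, abs_zero, max_eq_right (abs_nonneg _), norm_sub_rev]
    exact abs_norm_sub_norm_le _ _
  rw [dist_eq_norm, dist_eq_norm, key]
  refine (norm_add_le _ _).trans ?_
  rw [norm_smul, norm_smul, Real.norm_of_nonneg h0, norm_mul, Real.norm_of_nonneg h0, norm_div,
    Real.norm_of_nonneg hy.le, Real.norm_eq_abs]
  have h3 : |max R ‖y‖ - max R ‖x‖| / max R ‖y‖ * ‖y‖ ≤ ‖x - y‖ := by
    rw [div_mul_eq_mul_div, div_le_iff₀ hy]
    exact mul_le_mul h2 (le_max_right _ _) (norm_nonneg _) (norm_nonneg _)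
  have h4 : 0 ≤ |max R ‖y‖ - max R ‖x‖| / max R ‖y‖ * ‖y‖ := by positivity
  have h5 := mul_le_mul h1 h3 h4 zero_le_one
  have h6 := mul_le_mul_of_nonneg_right h1 (norm_nonneg (x - y))
  rw [mul_assoc]
  push_cast
  linarith

end Cutoff

/-- A linear equation with continuous coefficients has a solution on all of a compact interval:
cutting the vector field off outside a ball makes Picard-Lindelöf global, and the growth estimate
shows that the solution never reaches the cutoff. -/
theorem exists_linearODE_Icc {F : Type*} [NormedAddCommGroup F] [InnerProductSpace ℝ F]
    [CompleteSpace F] {a b : ℝ} (hab : a ≤ b) {B : ℝ → F →L[ℝ] F}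
    (hB : ContinuousOn B (Icc a b)) (x₀ : F) :
    ∃ X : ℝ → F, X a = x₀ ∧ ∀ t ∈ Icc a b, HasDerivWithinAt X (B t (X t)) (Icc a b) t := by
  obtain ⟨K₀, hK₀⟩ := isCompact_Icc.exists_bound_of_continuousOn hB
  set K : ℝ := max K₀ 0
  have hK : ∀ t ∈ Icc a b, ‖B t‖ ≤ K := fun t ht => (hK₀ t ht).trans (le_max_left _ _)
  have hK0 : 0 ≤ K := le_max_right _ _
  set R : ℝ := Real.exp (K * b - K * a) * ‖x₀‖ + 1
  have hR : 0 < R := by positivity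
  have hba : 0 ≤ b - a := sub_nonneg.2 hab
  have hPL : IsPicardLindelof (fun t x => B t (radialCutoff R x))
      (⟨a, left_mem_Icc.2 hab⟩ : Icc a b) x₀ (⟨K * R * (b - a), by positivity⟩ : NNReal)
      0 ⟨K * R, by positivity⟩
      (⟨K, hK0⟩ * 2 : NNReal) := by
    refine ⟨fun t ht => ?_, fun x _ => ?_, fun t ht x _ => ?_, ?_⟩
    · refine LipschitzWith.lipschitzOnWith (LipschitzWith.comp ?_ (lipschitzWith_radialCutoff hR))
      exact (B t).lipschitz.weaken (hK t ht)
    · exact hB.clm_apply continuousOn_const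
    · exact (B t).le_of_opNorm_le_of_le (hK t ht) (norm_radialCutoff_le hR x)
    · simp only [sub_self, NNReal.coe_zero, sub_zero, max_eq_left hba]
      exact le_rfl
  obtain ⟨X, hX0, hX⟩ := hPL.exists_eq_forall_mem_Icc_hasDerivWithinAt₀
  refine ⟨X, hX0, fun t ht => ?_⟩
  have hbound : ‖X t‖ ≤ R := by
    have h := norm_le_exp_mul_norm (convex_Icc a b) hX (τ := fun t => K * t) (τ' := fun _ => K)
      (fun t _ => by simpa using (hasDerivWithinAt_id t (Icc a b)).const_mul K)
      (fun t ht => (B t).le_of_opNorm_le_of_le (hK t ht) (norm_radialCutoff_le_norm hR _))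
      (left_mem_Icc.2 hab) ht ht.1
    have hX0' : X a = x₀ := hX0
    rw [hX0'] at h
    refine h.trans ?_
    have : Real.exp (K * t - K * a) ≤ Real.exp (K * b - K * a) := by
      have := ht.2
      gcongr
    have := mul_le_mul_of_nonneg_right this (norm_nonneg x₀)
    linarith
  have h := hX t ht
  simp only [radialCutoff_of_norm_le hR hbound] at h
  exact h

/-- Solutions of a linear equation with the same initial value agree. -/
theorem linearODE_unique {F : Type*} [NormedAddCommGroup F] [InnerProductSpace ℝ F]
    {a b : ℝ} {B : ℝ → F →L[ℝ] F} (hB : ContinuousOn B (Icc a b)) {X Y : ℝ → F} (h0 : X a = Y a)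
    (hX : ∀ t ∈ Icc a b, HasDerivWithinAt X (B t (X t)) (Icc a b) t)
    (hY : ∀ t ∈ Icc a b, HasDerivWithinAt Y (B t (Y t)) (Icc a b) t) :
    EqOn X Y (Icc a b) := by
  intro t ht
  obtain ⟨K, hK⟩ := isCompact_Icc.exists_bound_of_continuousOn hB
  have h := norm_le_exp_mul_norm (convex_Icc a b) (X := fun t => X t - Y t)
    (fun t ht => (hX t ht).sub (hY t ht)) (τ := fun t => K * t) (τ' := fun _ => K)
    (fun t _ => by simpa using (hasDerivWithinAt_id t (Icc a b)).const_mul K)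
    (fun t ht => by rw [← map_sub]; exact (B t).le_of_opNorm_le (hK t ht) _)
    (left_mem_Icc.2 (ht.1.trans ht.2)) ht ht.1
  rw [h0, sub_self, norm_zero, mul_zero] at h
  exact sub_eq_zero.1 (norm_le_zero_iff.1 h)

/-- A linear equation with continuous coefficients has a solution on all of a half-open interval,
obtained by patching the solutions on compact subintervals. -/
theorem exists_linearODE_Ico {F : Type*} [NormedAddCommGroup F] [InnerProductSpace ℝ F]
    [CompleteSpace F] {a b : ℝ} (hab : a < b) {B : ℝ → F →L[ℝ] F}
    (hB : ContinuousOn B (Ico a b)) (x₀ : F) :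
    ∃ X : ℝ → F, X a = x₀ ∧ ∀ t ∈ Ico a b, HasDerivWithinAt X (B t (X t)) (Ico a b) t := by
  have hex : ∀ c, ∃ X : ℝ → F, c ∈ Ico a b → X a = x₀ ∧
      ∀ t ∈ Icc a c, HasDerivWithinAt X (B t (X t)) (Icc a c) t := fun c => by
    by_cases hc : c ∈ Ico a b
    · obtain ⟨X, hX⟩ := exists_linearODE_Icc hc.1 (hB.mono (Icc_subset_Ico_right hc.2)) x₀
      exact ⟨X, fun _ => hX⟩
    · exact ⟨fun _ => 0, fun h => absurd h hc⟩
  choose Y hY using hex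
  -- A point strictly between `t` and `b`.
  let c : ℝ → ℝ := fun t => (t + b) / 2
  have hc : ∀ t ∈ Ico a b, t < c t ∧ c t ∈ Ico a b := fun t ht => by
    have h1 := ht.1
    have h2 := ht.2
    simp only [c, mem_Ico]
    refine ⟨?_, ?_, ?_⟩ <;> linarith
  have hagree : ∀ c₁ ∈ Ico a b, ∀ c₂ ∈ Ico a b, c₁ ≤ c₂ → EqOn (Y c₁) (Y c₂) (Icc a c₁) := by
    intro c₁ h₁ c₂ h₂ h12
    have hsub : Icc a c₁ ⊆ Icc a c₂ := Icc_subset_Icc_right h12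
    exact linearODE_unique (hB.mono (Icc_subset_Ico_right h₁.2))
      ((hY c₁ h₁).1.trans (hY c₂ h₂).1.symm) (hY c₁ h₁).2
      fun t ht => ((hY c₂ h₂).2 t (hsub ht)).mono hsub
  have ha : a ∈ Ico a b := left_mem_Ico.2 hab
  refine ⟨fun t => Y (c t) t, (hY _ (hc a ha).2).1, fun t ht => ?_⟩
  obtain ⟨htc, hct⟩ := hc t ht
  have hev : (fun s => Y (c s) s) =ᶠ[𝓝[Ico a b] t] Y (c t) := by
    filter_upwards [self_mem_nhdsWithin, mem_nhdsWithin_of_mem_nhds (Iio_mem_nhds htc)]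
      with s hs hsc
    obtain ⟨hsc', hcs⟩ := hc s hs
    rcases le_total (c s) (c t) with h | h
    · exact hagree _ hcs _ hct h ⟨hs.1, hsc'.le⟩
    · exact (hagree _ hct _ hcs h ⟨hs.1, (show s < c t from hsc).le⟩).symm
  have hd := (hY _ hct).2 t ⟨ht.1, htc.le⟩
  refine HasDerivWithinAt.congr_of_eventuallyEq ?_ hev rfl
  refine hd.mono_of_mem_nhdsWithin ?_
  filter_upwards [self_mem_nhdsWithin, mem_nhdsWithin_of_mem_nhds (Iio_mem_nhds htc)] with s hs hsc
  exact ⟨hs.1, (show s < c t from hsc).le⟩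

/-! ### Tangent vectors in coordinates -/

section Coordinates

variable {d : ℕ} {M : Type*} [TopologicalSpace M] [ChartedSpace (Coord d) M]

/-- The tangent vector at the point with coordinates `y` whose components are `u`. -/
def ofCoord (e : OpenPartialHomeomorph M (Coord d)) (y u : Coord d) :
    TangentSpace (𝓡 (d + 1)) (e.symm y) :=
  mfderiv (𝓡 (d + 1)) (𝓡 (d + 1)) e.symm y u

theorem sum_smul_single (u : Coord d) :
    ∑ μ, u μ • (EuclideanSpace.single μ (1 : ℝ) : Coord d) = u := by
  ext i
  simp [Finset.sum_apply, Pi.single_apply]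

/-- The coordinate change from the chart `e` to the chart `e'`. -/
def transition (e e' : OpenPartialHomeomorph M (Coord d)) (y : Coord d) : Coord d :=
  e' (e.symm y)

theorem contDiffAt_transition {e e' : OpenPartialHomeomorph M (Coord d)} (he : IsSmoothChart e)
    (he' : IsSmoothChart e') {x : M} (hx : x ∈ e.source) (hx' : x ∈ e'.source) :
    ContDiffAt ℝ ∞ (transition e e') (e x) := by
  rw [← contMDiffAt_iff_contDiffAt]
  refine ContMDiffAt.comp (I' := 𝓡 (d + 1)) (e x) (g := e') ?_
    (contMDiffAt_symm_of_mem_maximalAtlas he (e.map_source hx))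
  rw [e.left_inv hx]
  exact contMDiffAt_of_mem_maximalAtlas he' hx'

theorem IsSmoothChart.mdifferentiable {e : OpenPartialHomeomorph M (Coord d)}
    (he : IsSmoothChart e) : e.MDifferentiable (𝓡 (d + 1)) (𝓡 (d + 1)) :=
  ⟨fun _ hx => ((contMDiffAt_of_mem_maximalAtlas he hx).mdifferentiableAt
      (by simp)).mdifferentiableWithinAt,
    fun _ hx => ((contMDiffAt_symm_of_mem_maximalAtlas he hx).mdifferentiableAt
      (by simp)).mdifferentiableWithinAt⟩

theorem inCoord_ofCoord {e : OpenPartialHomeomorph M (Coord d)} (he : IsSmoothChart e)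
    {y : Coord d} (hy : y ∈ e.target) (u : Coord d) : inCoord e (e.symm y) (ofCoord e y u) = u := by
  have h := he.mdifferentiable.comp_symm_deriv hy
  exact congrArg (fun L => L u) h

theorem inCoord_injective {e : OpenPartialHomeomorph M (Coord d)} (he : IsSmoothChart e)
    {x : M} (hx : x ∈ e.source) : Function.Injective (inCoord e x) :=
  he.mdifferentiable.mfderiv_injective hx

theorem inCoord_surjective {e : OpenPartialHomeomorph M (Coord d)} (he : IsSmoothChart e)
    {x : M} (hx : x ∈ e.source) : Function.Surjective (inCoord e x) :=
  he.mdifferentiable.mfderiv_surjective hx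

theorem ofCoord_inCoord {e : OpenPartialHomeomorph M (Coord d)} (he : IsSmoothChart e)
    {y : Coord d} (hy : y ∈ e.target) (v : TangentSpace (𝓡 (d + 1)) (e.symm y)) :
    ofCoord e y (inCoord e (e.symm y) v) = v :=
  inCoord_injective he (e.map_target hy) (inCoord_ofCoord he hy _)

/-- The components of a tangent vector as a linear equivalence. -/
def inCoordEquiv {e : OpenPartialHomeomorph M (Coord d)} (he : IsSmoothChart e)
    {x : M} (hx : x ∈ e.source) : TangentSpace (𝓡 (d + 1)) x ≃ₗ[ℝ] Coord d :=
  LinearEquiv.ofBijective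
    (mfderiv (𝓡 (d + 1)) (𝓡 (d + 1)) e x).toLinearMap
    ⟨inCoord_injective he hx, inCoord_surjective he hx⟩

theorem inCoordEquiv_apply {e : OpenPartialHomeomorph M (Coord d)} (he : IsSmoothChart e)
    {x : M} (hx : x ∈ e.source) (v : TangentSpace (𝓡 (d + 1)) x) :
    inCoordEquiv he hx v = inCoord e x v := rfl

theorem tangentBundle_ext {e : OpenPartialHomeomorph M (Coord d)} (he : IsSmoothChart e)
    {x x' : M} (hx : x ∈ e.source) (hxx : x = x') {v : TangentSpace (𝓡 (d + 1)) x}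
    {v' : TangentSpace (𝓡 (d + 1)) x'} (h : inCoord e x v = inCoord e x' v') :
    (⟨x, v⟩ : TangentBundle (𝓡 (d + 1)) M) = ⟨x', v'⟩ := by
  subst hxx
  rw [inCoord_injective he hx h]

theorem inCoord_transition {e e' : OpenPartialHomeomorph M (Coord d)} (he : IsSmoothChart e)
    (he' : IsSmoothChart e') {x : M} (hx : x ∈ e.source) (hx' : x ∈ e'.source)
    (v : TangentSpace (𝓡 (d + 1)) x) :
    inCoord e' x v = fderiv ℝ (transition e e') (e x) (inCoord e x v) := by
  have hev : (e' : M → Coord d) =ᶠ[𝓝 x] transition e e' ∘ e := by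
    filter_upwards [e.open_source.mem_nhds hx] with z hz
    simp [transition, e.left_inv hz]
  have h1 : mfderiv (𝓡 (d + 1)) (𝓡 (d + 1)) e' x =
      mfderiv (𝓡 (d + 1)) (𝓡 (d + 1)) (transition e e' ∘ e) x := hev.mfderiv_eq
  have hd : MDifferentiableAt (𝓡 (d + 1)) (𝓡 (d + 1)) (transition e e') (e x) :=
    ((contDiffAt_transition he he' hx hx').differentiableAt (by simp)).mdifferentiableAt
  have h2 := mfderiv_comp x hd (he.mdifferentiable.mdifferentiableAt hx)
  have h3 : mfderiv (𝓡 (d + 1)) (𝓡 (d + 1)) (transition e e') (e x) =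
      fderiv ℝ (transition e e') (e x) := mfderiv_eq_fderiv
  change mfderiv (𝓡 (d + 1)) (𝓡 (d + 1)) e' x v = _
  rw [h1, h2, h3]
  rfl

/-- The velocity of a differentiable curve has as components the derivatives of its coordinates. -/
theorem hasDerivWithinAt_coord {e : OpenPartialHomeomorph M (Coord d)} (he : IsSmoothChart e)
    {γ : ℝ → M} {S : Set ℝ} {t : ℝ}
    (hγ : MDifferentiableWithinAt 𝓘(ℝ) (𝓡 (d + 1)) γ S t) (hx : γ t ∈ e.source) :
    HasDerivWithinAt (fun s => e (γ s)) (inCoord e (γ t) (velocity d γ S t)) S t := by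
  have h := (he.mdifferentiable.mdifferentiableAt hx).hasMFDerivAt.comp_hasMFDerivWithinAt t
    hγ.hasMFDerivWithinAt
  let D : ℝ →L[ℝ] Coord d := (mfderiv (𝓡 (d + 1)) (𝓡 (d + 1)) e (γ t)).comp
    (mfderivWithin 𝓘(ℝ) (𝓡 (d + 1)) γ S t)
  have h2 : HasFDerivWithinAt (fun s => e (γ s)) D S t :=
    hasMFDerivWithinAt_iff_hasFDerivWithinAt.1 h
  exact h2.hasDerivWithinAt

/-- The velocity of a continuously differentiable curve has continuous components. -/
theorem continuousOn_inCoord_velocity {e : OpenPartialHomeomorph M (Coord d)}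
    (he : IsSmoothChart e) {γ : ℝ → M} {S : Set ℝ} (hS : UniqueDiffOn ℝ S)
    (hγ : ContMDiffOn 𝓘(ℝ) (𝓡 (d + 1)) 1 γ S) (hx : ∀ t ∈ S, γ t ∈ e.source) :
    ContinuousOn (fun t => inCoord e (γ t) (velocity d γ S t)) S := by
  have h : ContDiffOn ℝ 1 (fun s => e (γ s)) S := by
    rw [← contMDiffOn_iff_contDiffOn]
    exact ((contMDiffOn_of_mem_maximalAtlas he).of_le (by simp)).comp hγ hx
  refine (h.continuousOn_derivWithin hS le_rfl).congr fun t ht => ?_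
  exact ((hasDerivWithinAt_coord he (hγ.mdifferentiableOn (by simp) t ht)
    (hx t ht)).derivWithin (hS t ht)).symm

end Coordinates

/-! ### The metric and the Levi-Civita connection in coordinates -/

theorem minkowskiMatrix_mul_self (d : ℕ) : minkowskiMatrix d * minkowskiMatrix d = 1 := by
  rw [minkowskiMatrix, Matrix.diagonal_mul_diagonal, ← Matrix.diagonal_one]
  congr 1
  ext μ
  split_ifs <;> norm_num

namespace LorentzianMetric

variable {d : ℕ} {M : Type*} [TopologicalSpace M] [ChartedSpace (Coord d) M]
  (g : LorentzianMetric d M) (e : OpenPartialHomeomorph M (Coord d))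

/-- The matrix of metric components. -/
def coeffMatrix (y : Coord d) : Matrix (Fin (d + 1)) (Fin (d + 1)) ℝ :=
  Matrix.of fun a b => g.coeff e a b y

/-- The metric in coordinates, as a bilinear form in the components of tangent vectors. -/
def bilin (y u v : Coord d) : ℝ := ∑ μ, ∑ ν, g.coeff e μ ν y * u μ * v ν

/-- The derivative of the metric components in the direction `a`, as a bilinear form. -/
def dBilin (y a u v : Coord d) : ℝ := ∑ κ, ∑ μ, ∑ ν, g.dCoeff e κ μ ν y * a κ * u μ * v ν

/-- The Christoffel symbols as a bilinear map with values in the coordinate space. -/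
def christoffelMap (y u v : Coord d) : Coord d :=
  WithLp.toLp 2 fun μ => ∑ ρ, ∑ σ, g.christoffel e μ ρ σ y * u ρ * v σ

theorem christoffelMap_apply (y u v : Coord d) (μ : Fin (d + 1)) :
    g.christoffelMap e y u v μ = ∑ ρ, ∑ σ, g.christoffel e μ ρ σ y * u ρ * v σ := rfl

variable {g e}

theorem coeff_symm (μ ν : Fin (d + 1)) : g.coeff e μ ν = g.coeff e ν μ := by
  ext y
  exact g.symm _ _ _

theorem dCoeff_symm (κ μ ν : Fin (d + 1)) : g.dCoeff e κ μ ν = g.dCoeff e κ ν μ := by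
  ext y
  rw [dCoeff, dCoeff, coeff_symm]

theorem bilin_symm (y u v : Coord d) : g.bilin e y u v = g.bilin e y v u := by
  rw [bilin, bilin, Finset.sum_comm]
  refine Finset.sum_congr rfl fun μ _ => Finset.sum_congr rfl fun ν _ => ?_
  rw [coeff_symm]
  ring

theorem dBilin_symm (y a u v : Coord d) : g.dBilin e y a u v = g.dBilin e y a v u := by
  refine Finset.sum_congr rfl fun κ _ => ?_
  rw [Finset.sum_comm]
  refine Finset.sum_congr rfl fun μ _ => Finset.sum_congr rfl fun ν _ => ?_
  rw [dCoeff_symm]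
  ring

theorem bilin_add_right (y u v w : Coord d) :
    g.bilin e y u (v + w) = g.bilin e y u v + g.bilin e y u w := by
  simp [bilin, mul_add, Finset.sum_add_distrib]

theorem bilin_smul_right (c : ℝ) (y u v : Coord d) :
    g.bilin e y u (c • v) = c * g.bilin e y u v := by
  simp only [bilin, Finset.mul_sum, PiLp.smul_apply, smul_eq_mul]
  refine Finset.sum_congr rfl fun μ _ => Finset.sum_congr rfl fun ν _ => ?_
  ring

theorem bilin_neg_right (y u v : Coord d) : g.bilin e y u (-v) = -g.bilin e y u v := by
  simpa using bilin_smul_right (g := g) (e := e) (-1) y u v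

theorem bilin_neg_left (y u v : Coord d) : g.bilin e y (-u) v = -g.bilin e y u v := by
  rw [bilin_symm, bilin_neg_right, bilin_symm]

theorem bilin_eq_sum_mulVec (y u v : Coord d) :
    g.bilin e y u v = ∑ μ, u μ * (g.coeffMatrix e y).mulVec v μ := by
  simp only [bilin, Matrix.mulVec, dotProduct, Finset.mul_sum, coeffMatrix, Matrix.of_apply]
  refine Finset.sum_congr rfl fun μ _ => Finset.sum_congr rfl fun ν _ => ?_
  ring

/-- The value of the metric on two tangent vectors, computed from their components. -/
theorem form_eq_bilin (he : IsSmoothChart e) {x : M} (hx : x ∈ e.source)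
    (v w : TangentSpace (𝓡 (d + 1)) x) :
    g.form x v w = g.bilin e (e x) (inCoord e x v) (inCoord e x w) := by
  have key : ∀ y ∈ e.target, ∀ v w : TangentSpace (𝓡 (d + 1)) (e.symm y),
      g.form (e.symm y) v w =
        g.bilin e y (inCoord e (e.symm y) v) (inCoord e (e.symm y) w) := by
    intro y hy v w
    have hexp : ∀ v : TangentSpace (𝓡 (d + 1)) (e.symm y),
        v = ∑ μ, inCoord e (e.symm y) v μ • coordVec e μ y := by
      intro v
      have h1 : ∑ μ, inCoord e (e.symm y) v μ • coordVec e μ y =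
          mfderiv (𝓡 (d + 1)) (𝓡 (d + 1)) e.symm y
            (∑ μ, inCoord e (e.symm y) v μ • (EuclideanSpace.single μ (1 : ℝ) : Coord d)) := by
        refine Eq.trans ?_ (map_sum (mfderiv (𝓡 (d + 1)) (𝓡 (d + 1)) e.symm y) _ _).symm
        refine Finset.sum_congr rfl fun μ _ => ?_
        exact (map_smul (mfderiv (𝓡 (d + 1)) (𝓡 (d + 1)) e.symm y) _ _).symm
      rw [h1]
      refine (ofCoord_inCoord he hy v).symm.trans ?_
      exact congrArg (mfderiv (𝓡 (d + 1)) (𝓡 (d + 1)) e.symm y)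
        (sum_smul_single (inCoord e (e.symm y) v)).symm
    conv_lhs => rw [hexp v, hexp w]
    simp only [map_sum, LinearMap.sum_apply, map_smul, LinearMap.smul_apply, smul_eq_mul]
    rw [bilin]
    rw [Finset.sum_comm]
    refine Finset.sum_congr rfl fun ν _ => ?_
    rw [Finset.mul_sum]
    refine Finset.sum_congr rfl fun μ _ => ?_
    rw [coeff]
    ring
  have h := key (e x) (e.map_source hx)
  rw [e.left_inv hx] at h
  exact h v w

theorem exists_orthonormal_bilin (he : IsSmoothChart e) {y : Coord d} (hy : y ∈ e.target) :
    ∃ b : Module.Basis (Fin (d + 1)) ℝ (Coord d),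
      ∀ α β, g.bilin e y (b α) (b β) = minkowskiMatrix d α β := by
  obtain ⟨b, hb⟩ := g.exists_orthonormal (e.symm y)
  refine ⟨b.map (inCoordEquiv he (e.map_target hy)), fun α β => ?_⟩
  rw [Module.Basis.map_apply, Module.Basis.map_apply, inCoordEquiv_apply, inCoordEquiv_apply, ← hb,
    form_eq_bilin he (e.map_target hy), e.right_inv hy]

theorem isUnit_det_coeffMatrix (he : IsSmoothChart e) {y : Coord d} (hy : y ∈ e.target) :
    IsUnit (g.coeffMatrix e y).det := by
  obtain ⟨b, hb⟩ := exists_orthonormal_bilin (g := g) he hy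
  set P : Matrix (Fin (d + 1)) (Fin (d + 1)) ℝ := Matrix.of fun α μ => b α μ
  have h : P * (g.coeffMatrix e y * P.transpose) = minkowskiMatrix d := by
    ext α β
    rw [← hb, bilin_eq_sum_mulVec, Matrix.mul_apply]
    rfl
  have h2 : P.det * ((g.coeffMatrix e y).det * P.det) * (minkowskiMatrix d).det = 1 := by
    rw [← Matrix.det_one (n := Fin (d + 1)), ← minkowskiMatrix_mul_self, Matrix.det_mul,
      ← h, Matrix.det_mul, Matrix.det_mul, Matrix.det_transpose]
  rw [isUnit_iff_ne_zero]
  intro h0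
  simp [h0] at h2

/-- Nondegeneracy: the metric separates tangent vectors. -/
theorem eq_of_bilin_eq (he : IsSmoothChart e) {y : Coord d} (hy : y ∈ e.target) {u v : Coord d}
    (h : ∀ w, g.bilin e y w u = g.bilin e y w v) : u = v := by
  have h1 : ∀ z : Coord d, ∀ μ, g.bilin e y (EuclideanSpace.single μ 1) z =
      (g.coeffMatrix e y).mulVec z μ := fun z μ => by
    rw [bilin_eq_sum_mulVec]
    simp
  have h2 : (g.coeffMatrix e y).mulVec u = (g.coeffMatrix e y).mulVec v := by
    ext μ
    rw [← h1, ← h1, h]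
  have h3 := (Matrix.mulVec_injective_iff_isUnit).2
    ((Matrix.isUnit_iff_isUnit_det _).2 (isUnit_det_coeffMatrix (g := g) he hy)) h2
  ext i
  exact congrFun h3 i

/-- The Koszul formula, which characterises the Christoffel symbols. -/
theorem bilin_christoffelMap (he : IsSmoothChart e) {y : Coord d} (hy : y ∈ e.target)
    (u v w : Coord d) :
    g.bilin e y w (g.christoffelMap e y u v) =
      (g.dBilin e y u w v + g.dBilin e y v w u - g.dBilin e y w u v) / 2 := by
  set K : Fin (d + 1) → ℝ := fun ν => ∑ ρ, ∑ σ,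
    (g.dCoeff e ρ ν σ y + g.dCoeff e σ ν ρ y - g.dCoeff e ν ρ σ y) * u ρ * v σ
  have hΓ : (g.christoffelMap e y u v : Fin (d + 1) → ℝ) =
      (g.coeffMatrix e y)⁻¹.mulVec ((1 / 2 : ℝ) • K) := by
    ext μ
    rw [christoffelMap_apply]
    simp only [christoffel, Matrix.mulVec, dotProduct, Pi.smul_apply, smul_eq_mul, K,
      Finset.mul_sum, Finset.sum_mul]
    rw [Finset.sum_comm_cycle]
    refine Finset.sum_congr rfl fun ν _ => ?_
    refine Finset.sum_congr rfl fun ρ _ => Finset.sum_congr rfl fun σ _ => ?_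
    rw [coeffMatrix]
    ring
  rw [bilin_eq_sum_mulVec, hΓ, Matrix.mulVec_mulVec,
    Matrix.mul_nonsing_inv _ (isUnit_det_coeffMatrix he hy), Matrix.one_mulVec]
  have e1 : g.dBilin e y u w v = ∑ ν, w ν * ∑ ρ, ∑ σ, g.dCoeff e ρ ν σ y * u ρ * v σ := by
    rw [dBilin, Finset.sum_comm]
    refine Finset.sum_congr rfl fun ν _ => ?_
    rw [Finset.mul_sum]
    refine Finset.sum_congr rfl fun ρ _ => ?_
    rw [Finset.mul_sum]
    exact Finset.sum_congr rfl fun σ _ => by ring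
  have e2 : g.dBilin e y v w u = ∑ ν, w ν * ∑ ρ, ∑ σ, g.dCoeff e σ ν ρ y * u ρ * v σ := by
    rw [dBilin, Finset.sum_comm]
    refine Finset.sum_congr rfl fun ν _ => ?_
    rw [Finset.mul_sum, Finset.sum_comm]
    refine Finset.sum_congr rfl fun ρ _ => ?_
    rw [Finset.mul_sum]
    exact Finset.sum_congr rfl fun σ _ => by ring
  have e3 : g.dBilin e y w u v = ∑ ν, w ν * ∑ ρ, ∑ σ, g.dCoeff e ν ρ σ y * u ρ * v σ := by
    rw [dBilin]
    refine Finset.sum_congr rfl fun ν _ => ?_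
    rw [Finset.mul_sum]
    refine Finset.sum_congr rfl fun ρ _ => ?_
    rw [Finset.mul_sum]
    exact Finset.sum_congr rfl fun σ _ => by ring
  rw [e1, e2, e3, ← Finset.sum_add_distrib, ← Finset.sum_sub_distrib, Finset.sum_div]
  refine Finset.sum_congr rfl fun ν _ => ?_
  have : K ν = ∑ ρ, ∑ σ, g.dCoeff e ρ ν σ y * u ρ * v σ +
      ∑ ρ, ∑ σ, g.dCoeff e σ ν ρ y * u ρ * v σ - ∑ ρ, ∑ σ, g.dCoeff e ν ρ σ y * u ρ * v σ := by
    simp only [K, ← Finset.sum_add_distrib, ← Finset.sum_sub_distrib, add_mul, sub_mul]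
  rw [Pi.smul_apply, smul_eq_mul, this]
  ring

/-- Compatibility of the Christoffel symbols with the metric. -/
theorem dBilin_eq_add (he : IsSmoothChart e) {y : Coord d} (hy : y ∈ e.target)
    (a u v : Coord d) :
    g.dBilin e y a u v =
      g.bilin e y (g.christoffelMap e y a u) v + g.bilin e y u (g.christoffelMap e y a v) := by
  rw [bilin_symm, bilin_christoffelMap he hy, bilin_christoffelMap he hy, dBilin_symm y a v u,
    dBilin_symm y u v a, dBilin_symm y v u a]
  ring

/-- The product rule for the metric along a curve. -/
theorem hasDerivWithinAt_bilin {S : Set ℝ} {t : ℝ} {y u v : ℝ → Coord d} {y' u' v' : Coord d}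
    (hg : ∀ μ ν, DifferentiableAt ℝ (g.coeff e μ ν) (y t))
    (hy : HasDerivWithinAt y y' S t) (hu : HasDerivWithinAt u u' S t)
    (hv : HasDerivWithinAt v v' S t) :
    HasDerivWithinAt (fun s => g.bilin e (y s) (u s) (v s))
      (g.dBilin e (y t) y' (u t) (v t) + g.bilin e (y t) u' (v t) + g.bilin e (y t) (u t) v')
      S t := by
  have hcomp : ∀ {w : ℝ → Coord d} {w' : Coord d}, HasDerivWithinAt w w' S t → ∀ μ,
      HasDerivWithinAt (fun s => w s μ) (w' μ) S t := fun hw μ =>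
    (EuclideanSpace.proj (𝕜 := ℝ) μ).hasFDerivAt.comp_hasDerivWithinAt t hw
  have hc : ∀ μ ν, HasDerivWithinAt (fun s => g.coeff e μ ν (y s))
      (∑ κ, g.dCoeff e κ μ ν (y t) * y' κ) S t := fun μ ν => by
    have h := (hg μ ν).hasFDerivAt.comp_hasDerivWithinAt t hy
    refine h.congr_deriv ?_
    refine (congrArg (fderiv ℝ (g.coeff e μ ν) (y t)) (sum_smul_single y')).symm.trans ?_
    rw [map_sum]
    refine Finset.sum_congr rfl fun κ _ => ?_
    rw [map_smul, smul_eq_mul, dCoeff, mul_comm]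
  have h : HasDerivWithinAt (fun s => g.bilin e (y s) (u s) (v s))
      (∑ μ, ∑ ν, (((∑ κ, g.dCoeff e κ μ ν (y t) * y' κ) * u t μ + g.coeff e μ ν (y t) * u' μ) *
        v t ν + g.coeff e μ ν (y t) * u t μ * v' ν)) S t := by
    refine HasDerivWithinAt.fun_sum fun μ _ => HasDerivWithinAt.fun_sum fun ν _ => ?_
    exact ((hc μ ν).mul (hcomp hu μ)).mul (hcomp hv ν)
  refine h.congr_deriv (Eq.symm ?_)
  rw [dBilin, Finset.sum_comm, bilin, bilin, ← Finset.sum_add_distrib, ← Finset.sum_add_distrib]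
  refine Finset.sum_congr rfl fun μ _ => ?_
  rw [Finset.sum_comm, ← Finset.sum_add_distrib, ← Finset.sum_add_distrib]
  refine Finset.sum_congr rfl fun ν _ => ?_
  rw [add_mul, Finset.sum_mul, Finset.sum_mul]

end LorentzianMetric

/-! ### Change of charts and parallel transport -/

theorem two_le_smooth : (2 : ℕ∞ω) ≤ (∞ : ℕ∞ω) := 
  WithTop.coe_le_coe.2 (le_top : (2 : ℕ∞) ≤ ⊤)

theorem one_add_one_le_smooth : (1 + 1 : ℕ∞ω) ≤ (∞ : ℕ∞ω) :=
  one_add_one_eq_two.trans_le two_le_smooth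

namespace LorentzianMetric

section ChangeOfCharts

variable {d : ℕ} {M : Type*} [TopologicalSpace M] [ChartedSpace (Coord d) M]
  {g : LorentzianMetric d M} {e e' : OpenPartialHomeomorph M (Coord d)}

theorem bilin_transition (he : IsSmoothChart e) (he' : IsSmoothChart e') {x : M}
    (hx : x ∈ e.source) (hx' : x ∈ e'.source) (u v : Coord d) :
    g.bilin e (e x) u v = g.bilin e' (e' x) (fderiv ℝ (transition e e') (e x) u)
      (fderiv ℝ (transition e e') (e x) v) := by
  obtain ⟨u, rfl⟩ := inCoord_surjective he hx u
  obtain ⟨v, rfl⟩ := inCoord_surjective he hx v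
  rw [← form_eq_bilin he hx, ← inCoord_transition he he' hx hx', ← inCoord_transition he he' hx hx',
    form_eq_bilin he' hx']

theorem dBilin_transition (he : IsSmoothChart e) (he' : IsSmoothChart e') {x : M}
    (hx : x ∈ e.source) (hx' : x ∈ e'.source)
    (hg : ∀ μ ν, DifferentiableAt ℝ (g.coeff e μ ν) (e x))
    (hg' : ∀ μ ν, DifferentiableAt ℝ (g.coeff e' μ ν) (e' x)) (a u v : Coord d) :
    g.dBilin e (e x) a u v =
      g.dBilin e' (e' x) (fderiv ℝ (transition e e') (e x) a)
          (fderiv ℝ (transition e e') (e x) u) (fderiv ℝ (transition e e') (e x) v) +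
        g.bilin e' (e' x) (fderiv ℝ (fderiv ℝ (transition e e')) (e x) a u)
          (fderiv ℝ (transition e e') (e x) v) +
        g.bilin e' (e' x) (fderiv ℝ (transition e e') (e x) u)
          (fderiv ℝ (fderiv ℝ (transition e e')) (e x) a v) := by
  set ψ := transition e e' with hψdef
  have hψ : ContDiffAt ℝ ∞ ψ (e x) := contDiffAt_transition he he' hx hx'
  have hψx : ψ (e x) = e' x := by simp [hψdef, transition, e.left_inv hx]
  have hdψ : DifferentiableAt ℝ (fderiv ℝ ψ) (e x) :=
    (hψ.fderiv_right (m := 1) one_add_one_le_smooth).differentiableAt (by simp)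
  set c : ℝ → Coord d := fun t => e x + t • a
  have hc0 : c 0 = e x := by simp [c]
  have hc : HasDerivWithinAt c a univ 0 := by
    refine HasDerivAt.hasDerivWithinAt ?_
    exact (((hasDerivAt_id (0 : ℝ)).smul_const a).const_add (e x)).congr_deriv (one_smul ℝ a)
  have hψc : HasDerivWithinAt (fun t => ψ (c t)) (fderiv ℝ ψ (e x) a) univ 0 := by
    have h := (hψ.differentiableAt (by simp)).hasFDerivAt
    rw [← hc0] at h ⊢
    exact h.comp_hasDerivWithinAt 0 hc
  have hD : ∀ w : Coord d, HasDerivWithinAt (fun t => fderiv ℝ ψ (c t) w)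
      (fderiv ℝ (fderiv ℝ ψ) (e x) a w) univ 0 := fun w => by
    have h := hdψ.hasFDerivAt
    rw [← hc0] at h ⊢
    have h2 := (h.comp_hasDerivWithinAt 0 hc).clm_apply (hasDerivWithinAt_const (0 : ℝ) univ w)
    simpa using h2
  have hL := hasDerivWithinAt_bilin (g := g) (e := e) (by rw [hc0]; exact hg) hc
    (hasDerivWithinAt_const (0 : ℝ) univ u) (hasDerivWithinAt_const (0 : ℝ) univ v)
  have hR := hasDerivWithinAt_bilin (g := g) (e := e') (by rw [hc0, hψx]; exact hg') hψc
    (hD u) (hD v)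
  have hev : (fun t => g.bilin e (c t) u v) =ᶠ[𝓝 0]
      fun t => g.bilin e' (ψ (c t)) (fderiv ℝ ψ (c t) u) (fderiv ℝ ψ (c t) v) := by
    have hcont : Tendsto c (𝓝 0) (𝓝 (e x)) := by
      rw [← hc0]
      exact (hasDerivWithinAt_univ.1 hc).continuousAt
    have h1 : ∀ᶠ y in 𝓝 (e x), y ∈ e.target := e.open_target.mem_nhds (e.map_source hx)
    have h2 : ∀ᶠ y in 𝓝 (e x), e.symm y ∈ e'.source := by
      refine (e.continuousAt_symm (e.map_source hx)).eventually (e'.open_source.mem_nhds ?_)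
      rwa [e.left_inv hx]
    filter_upwards [hcont.eventually h1, hcont.eventually h2] with t ht1 ht2
    have h := bilin_transition (g := g) he he' (e.map_target ht1) ht2 u v
    rw [e.right_inv ht1] at h
    exact h
  have h := (hasDerivWithinAt_univ.1 hL).unique
    ((hasDerivWithinAt_univ.1 hR).congr_of_eventuallyEq hev)
  have hz : ∀ y w : Coord d, g.bilin e y w 0 = 0 ∧ g.bilin e y 0 w = 0 := fun y w => by
    simp [bilin]
  simpa [hc0, hψx, hz] using h

/-- The inhomogeneous transformation law of the Christoffel symbols. -/
theorem christoffelMap_transition (he : IsSmoothChart e) (he' : IsSmoothChart e') {x : M}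
    (hx : x ∈ e.source) (hx' : x ∈ e'.source)
    (hg : ∀ μ ν, DifferentiableAt ℝ (g.coeff e μ ν) (e x))
    (hg' : ∀ μ ν, DifferentiableAt ℝ (g.coeff e' μ ν) (e' x)) (u v : Coord d) :
    fderiv ℝ (transition e e') (e x) (g.christoffelMap e (e x) u v) =
      g.christoffelMap e' (e' x) (fderiv ℝ (transition e e') (e x) u)
          (fderiv ℝ (transition e e') (e x) v) +
        fderiv ℝ (fderiv ℝ (transition e e')) (e x) u v := by
  refine eq_of_bilin_eq he' (e'.map_source hx') (g := g) fun w' => ?_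
  obtain ⟨w, rfl⟩ : ∃ w, fderiv ℝ (transition e e') (e x) w = w' := by
    obtain ⟨w, rfl⟩ := inCoord_surjective he' hx' w'
    exact ⟨_, (inCoord_transition he he' hx hx' w).symm⟩
  have hsymm : ∀ a b, fderiv ℝ (fderiv ℝ (transition e e')) (e x) a b =
      fderiv ℝ (fderiv ℝ (transition e e')) (e x) b a := fun a b =>
    ((contDiffAt_transition he he' hx hx').isSymmSndFDerivAt (by simpa using two_le_smooth)) a b
  rw [← bilin_transition he he' hx hx', bilin_add_right, bilin_christoffelMap he (e.map_source hx),
    bilin_christoffelMap he' (e'.map_source hx'), dBilin_transition he he' hx hx' hg hg',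
    dBilin_transition he he' hx hx' hg hg', dBilin_transition he he' hx hx' hg hg',
    hsymm v w, hsymm u w, hsymm v u,
    bilin_symm _ (fderiv ℝ (fderiv ℝ (transition e e')) (e x) w u),
    bilin_symm _ (fderiv ℝ (fderiv ℝ (transition e e')) (e x) w v)]
  ring

theorem neg_christoffelMap_eq (y u v : Coord d) :
    (WithLp.toLp 2 fun μ => -∑ ρ, ∑ σ, g.christoffel e μ ρ σ y * u ρ * v σ) =
      -g.christoffelMap e y u v := rfl

/-- Parallelism can be checked in a single chart. -/
theorem isParallel_of_chart (he : IsSmoothChart e) {γ : ℝ → M} {S : Set ℝ}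
    {X : ∀ t : ℝ, TangentSpace (𝓡 (d + 1)) (γ t)}
    (hγ : ∀ t ∈ S, MDifferentiableWithinAt 𝓘(ℝ) (𝓡 (d + 1)) γ S t)
    (hsrc : ∀ t ∈ S, γ t ∈ e.source)
    (hg : ∀ e' : OpenPartialHomeomorph M (Coord d), IsSmoothChart e' → ∀ t ∈ S, γ t ∈ e'.source →
      ∀ μ ν, DifferentiableAt ℝ (g.coeff e' μ ν) (e' (γ t)))
    (hX : ∀ t ∈ S, HasDerivWithinAt (fun s => inCoord e (γ s) (X s))
      (-g.christoffelMap e (e (γ t)) (inCoord e (γ t) (velocity d γ S t)) (inCoord e (γ t) (X t)))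
      S t) :
    g.IsParallel γ S X := by
  intro e' he' t ht hx'
  have hx := hsrc t ht
  rw [neg_christoffelMap_eq]
  have hdψ : DifferentiableAt ℝ (fderiv ℝ (transition e e')) (e (γ t)) :=
    ((contDiffAt_transition he he' hx hx').fderiv_right (m := 1)
      one_add_one_le_smooth).differentiableAt (by simp)
  have hD : HasDerivWithinAt (fun s => fderiv ℝ (transition e e') (e (γ s)))
      (fderiv ℝ (fderiv ℝ (transition e e')) (e (γ t)) (inCoord e (γ t) (velocity d γ S t))) S t :=
    HasFDerivAt.comp_hasDerivWithinAt t hdψ.hasFDerivAt (hasDerivWithinAt_coord he (hγ t ht) hx)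
  have h := hD.clm_apply (hX t ht)
  have hev : (fun s => inCoord e' (γ s) (X s)) =ᶠ[𝓝[S] t]
      fun s => fderiv ℝ (transition e e') (e (γ s)) (inCoord e (γ s) (X s)) := by
    filter_upwards [self_mem_nhdsWithin,
      (hγ t ht).continuousWithinAt.preimage_mem_nhdsWithin (e'.open_source.mem_nhds hx')]
      with s hs hs'
    exact inCoord_transition he he' (hsrc s hs) hs' _
  refine (h.congr_of_eventuallyEq hev (hev.self_of_nhdsWithin ht)).congr_deriv ?_
  rw [map_neg, christoffelMap_transition he he' hx hx' (hg e he t ht hx) (hg e' he' t ht hx'),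
    ← inCoord_transition he he' hx hx', ← inCoord_transition he he' hx hx']
  abel

end ChangeOfCharts

end LorentzianMetric

/-! ### Regularity of the metric on the image of the embedding -/

namespace LorentzianMetric

section Regularity

variable {d : ℕ} {M M' : Type*} [TopologicalSpace M] [ChartedSpace (Coord d) M]
  [TopologicalSpace M'] [ChartedSpace (Coord d) M']
  {g : LorentzianMetric d M} {e : OpenPartialHomeomorph M (Coord d)}
  {g' : LorentzianMetric d M'} {e' : OpenPartialHomeomorph M' (Coord d)} {ι : M → M'}

theorem bilin_single (y : Coord d) (μ ν : Fin (d + 1)) :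
    g.bilin e y (EuclideanSpace.single μ 1) (EuclideanSpace.single ν 1) = g.coeff e μ ν y := by
  rw [bilin, Finset.sum_eq_single μ, Finset.sum_eq_single ν]
  · simp
  · intro ν' _ h
    simp [h]
  · simp
  · intro μ' _ h
    simp [h]
  · simp

theorem inCoord_mfderiv (he : IsSmoothChart e) (he' : IsSmoothChart e') {x : M}
    (hι : MDifferentiableAt (𝓡 (d + 1)) (𝓡 (d + 1)) ι x) (hx : x ∈ e.source)
    (hx' : ι x ∈ e'.source) (v : TangentSpace (𝓡 (d + 1)) x) :
    inCoord e' (ι x) (mfderiv (𝓡 (d + 1)) (𝓡 (d + 1)) ι x v) =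
      fderiv ℝ (fun y => e' (ι (e.symm y))) (e x) (inCoord e x v) := by
  have hι' : MDifferentiableAt (𝓡 (d + 1)) (𝓡 (d + 1)) ι (e.symm (e x)) := by
    rwa [e.left_inv hx]
  have hx'' : ι (e.symm (e x)) ∈ e'.source := by rwa [e.left_inv hx]
  have hF := ((he'.mdifferentiable.mdifferentiableAt hx'').comp (e x) (hι'.comp (e x)
    (he.mdifferentiable.mdifferentiableAt_symm (e.map_source hx))))
  have hev : (fun z => e' (ι z)) =ᶠ[𝓝 x] (fun y => e' (ι (e.symm y))) ∘ e := by
    filter_upwards [e.open_source.mem_nhds hx] with z hz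
    simp [e.left_inv hz]
  have h1 : mfderiv (𝓡 (d + 1)) (𝓡 (d + 1)) (fun z => e' (ι z)) x =
      mfderiv (𝓡 (d + 1)) (𝓡 (d + 1)) ((fun y => e' (ι (e.symm y))) ∘ e) x := hev.mfderiv_eq
  have h2 := mfderiv_comp x hF (he.mdifferentiable.mdifferentiableAt hx)
  have h3 := mfderiv_comp x (he'.mdifferentiable.mdifferentiableAt hx') hι
  have h4 : mfderiv (𝓡 (d + 1)) (𝓡 (d + 1)) (fun y => e' (ι (e.symm y))) (e x) =
      fderiv ℝ (fun y => e' (ι (e.symm y))) (e x) := mfderiv_eq_fderiv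
  have h5 := (h3.symm.trans h1).trans h2
  have h6 := congrArg (fun L : TangentSpace (𝓡 (d + 1)) x →L[ℝ] Coord d => L v) h5
  refine h6.trans ?_
  exact congrArg (fun L : Coord d →L[ℝ] Coord d => L (inCoord e x v)) h4

/-- An isometric immersion into a manifold of the same dimension is a local diffeomorphism, so that
the metric of the target inherits the regularity of the metric of the source. -/
theorem contDiffAt_coeff_of_isometric [IsManifold (𝓡 (d + 1)) ∞ M] (hg : g.IsC1)
    (hι : ContMDiff (𝓡 (d + 1)) (𝓡 (d + 1)) ∞ ι)
    (hiso : ∀ x (v w : TangentSpace (𝓡 (d + 1)) x),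
      g'.form (ι x) (mfderiv (𝓡 (d + 1)) (𝓡 (d + 1)) ι x v)
        (mfderiv (𝓡 (d + 1)) (𝓡 (d + 1)) ι x w) = g.form x v w)
    (he' : IsSmoothChart e') {x : M} (hx' : ι x ∈ e'.source) (μ ν : Fin (d + 1)) :
    ContDiffAt ℝ 1 (g'.coeff e' μ ν) (e' (ι x)) := by
  set κ := chartAt (Coord d) x
  have hκ : IsSmoothChart κ := IsManifold.chart_mem_maximalAtlas x
  have hx : x ∈ κ.source := mem_chart_source (Coord d) x
  have hιd : ∀ z, MDifferentiableAt (𝓡 (d + 1)) (𝓡 (d + 1)) ι z := fun z =>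
    (hι z).mdifferentiableAt (by simp)
  set F : Coord d → Coord d := fun y => e' (ι (κ.symm y)) with hFdef
  have hFx : F (κ x) = e' (ι x) := by simp [hFdef, κ.left_inv hx]
  have hF : ContDiffAt ℝ ∞ F (κ x) := by
    rw [← contMDiffAt_iff_contDiffAt]
    refine ContMDiffAt.comp (I' := 𝓡 (d + 1)) (κ x) (g := e') ?_
      (ContMDiffAt.comp (I' := 𝓡 (d + 1)) (κ x) (g := ι) (hι _)
        (contMDiffAt_symm_of_mem_maximalAtlas hκ (κ.map_source hx)))
    rw [κ.left_inv hx]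
    exact contMDiffAt_of_mem_maximalAtlas he' hx'
  -- Nondegeneracy of `g` makes the differential of an isometric map injective.
  have hinj : Function.Injective (fderiv ℝ F (κ x)) := by
    intro u v huv
    obtain ⟨u, rfl⟩ := inCoord_surjective hκ hx u
    obtain ⟨v, rfl⟩ := inCoord_surjective hκ hx v
    rw [← inCoord_mfderiv hκ he' (hιd x) hx hx', ← inCoord_mfderiv hκ he' (hιd x) hx hx'] at huv
    have huv' := inCoord_injective he' hx' huv
    refine eq_of_bilin_eq hκ (κ.map_source hx) (g := g) fun w => ?_
    obtain ⟨w, rfl⟩ := inCoord_surjective hκ hx w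
    rw [← form_eq_bilin hκ hx, ← form_eq_bilin hκ hx, ← hiso, ← hiso, huv']
  let F' : Coord d ≃L[ℝ] Coord d :=
    (LinearEquiv.ofInjectiveEndo (fderiv ℝ F (κ x)).toLinearMap hinj).toContinuousLinearEquiv
  have hF' : HasFDerivAt F (F' : Coord d →L[ℝ] Coord d) (κ x) := by
    have h : (F' : Coord d →L[ℝ] Coord d) = fderiv ℝ F (κ x) := by
      ext1 v
      rfl
    rw [h]
    exact (hF.differentiableAt (by simp)).hasFDerivAt
  set H := hF.localInverse hF' (by simp)
  have hH : ContDiffAt ℝ ∞ H (F (κ x)) := hF.to_localInverse hF' (by simp)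
  have hHx : H (F (κ x)) = κ x := hF.localInverse_apply_image hF' (by simp)
  have hFH : ∀ᶠ y in 𝓝 (F (κ x)), F (H y) = y :=
    (hF.hasStrictFDerivAt' hF' (by simp)).eventually_right_inverse
  have hH1 : ∀ᶠ y in 𝓝 (F (κ x)), ContDiffAt ℝ 1 H y :=
    (hH.of_le (by simp)).eventually (by simp)
  have hnear : ∀ᶠ y in 𝓝 (F (κ x)), H y ∈ κ.target ∧ ι (κ.symm (H y)) ∈ e'.source := by
    have hc : ContinuousAt H (F (κ x)) := hH.continuousAt
    have h1 : ∀ᶠ z in 𝓝 (H (F (κ x))), z ∈ κ.target := by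
      rw [hHx]
      exact κ.open_target.mem_nhds (κ.map_source hx)
    have h2 : ∀ᶠ z in 𝓝 (H (F (κ x))), ι (κ.symm z) ∈ e'.source := by
      rw [hHx]
      refine (hι.continuous.continuousAt.comp
        (κ.continuousAt_symm (κ.map_source hx))).eventually (e'.open_source.mem_nhds ?_)
      rwa [Function.comp_apply, κ.left_inv hx]
    exact hc.eventually (h1.and h2)
  have hformula : g'.coeff e' μ ν =ᶠ[𝓝 (F (κ x))] fun y =>
      g.bilin κ (H y) (fderiv ℝ H y (EuclideanSpace.single μ 1))
        (fderiv ℝ H y (EuclideanSpace.single ν 1)) := by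
    filter_upwards [hnear, hFH.eventually_nhds, hH1] with y hy hFy hHy
    obtain ⟨hy1, hy2⟩ := hy
    have hFyy : F (H y) = y := hFy.self_of_nhds
    set z := κ.symm (H y) with hz
    have hzs : z ∈ κ.source := κ.map_target hy1
    have hκz : κ z = H y := κ.right_inv hy1
    have hez : e' (ι z) = y := hFyy
    have hDF : DifferentiableAt ℝ F (H y) := by
      rw [← mdifferentiableAt_iff_differentiableAt]
      exact ((he'.mdifferentiable.mdifferentiableAt hy2).comp (H y) ((hιd _).comp (H y)
        (hκ.mdifferentiable.mdifferentiableAt_symm hy1)))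
    have hchain : (fderiv ℝ F (H y)).comp (fderiv ℝ H y) = ContinuousLinearMap.id ℝ (Coord d) := by
      rw [← fderiv_comp y hDF (hHy.differentiableAt (by simp))]
      have : F ∘ H =ᶠ[𝓝 y] id := hFy
      rw [this.fderiv_eq, fderiv_id]
    have hcomp : ∀ u : Coord d, ∃ v : TangentSpace (𝓡 (d + 1)) z, inCoord κ z v = fderiv ℝ H y u ∧
        inCoord e' (ι z) (mfderiv (𝓡 (d + 1)) (𝓡 (d + 1)) ι z v) = u := by
      intro u
      obtain ⟨v, hv⟩ := inCoord_surjective hκ hzs (fderiv ℝ H y u)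
      refine ⟨v, hv, ?_⟩
      rw [inCoord_mfderiv hκ he' (hιd z) hzs hy2, hv, hκz]
      exact congrArg (fun L : Coord d →L[ℝ] Coord d => L u) hchain
    obtain ⟨v, hv, hv'⟩ := hcomp (EuclideanSpace.single μ 1)
    obtain ⟨w, hw, hw'⟩ := hcomp (EuclideanSpace.single ν 1)
    rw [← bilin_single, ← hv, ← hw, ← hκz, ← form_eq_bilin hκ hzs, ← hiso, form_eq_bilin he' hy2,
      hv', hw', hez]
  rw [← hFx]
  refine ContDiffAt.congr_of_eventuallyEq ?_ hformula
  have hDH : ∀ (u : Coord d) (i : Fin (d + 1)),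
      ContDiffAt ℝ 1 (fun y => fderiv ℝ H y u i) (F (κ x)) := fun u i => by
    have h1 : ContDiffAt ℝ 1 (fun y => fderiv ℝ H y u) (F (κ x)) :=
      (hH.fderiv_right (m := 1) one_add_one_le_smooth).clm_apply contDiffAt_const
    exact (EuclideanSpace.proj (𝕜 := ℝ) i).contDiff.contDiffAt.comp _ h1
  have hcoeff : ∀ i j, ContDiffAt ℝ 1 (fun y => g.coeff κ i j (H y)) (F (κ x)) := fun i j => by
    have h1 : ContDiffAt ℝ 1 (g.coeff κ i j) (H (F (κ x))) := by
      rw [hHx]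
      exact (hg κ hκ i j).contDiffAt (κ.open_target.mem_nhds (κ.map_source hx))
    exact h1.comp _ (hH.of_le (by simp))
  exact ContDiffAt.sum fun i _ => ContDiffAt.sum fun j _ =>
    ((hcoeff i j).mul (hDH _ i)).mul (hDH _ j)

theorem continuousAt_inv_coeffMatrix (he : IsSmoothChart e) {y : Coord d} (hy : y ∈ e.target)
    (hg : ∀ μ ν, ContinuousAt (g.coeff e μ ν) y) :
    ContinuousAt (fun z => (g.coeffMatrix e z)⁻¹) y := by
  have hG : ContinuousAt (fun z => g.coeffMatrix e z) y :=
    continuousAt_pi.2 fun μ => continuousAt_pi.2 fun ν => hg μ ν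
  simp only [Matrix.inv_def, Ring.inverse_eq_inv']
  have h1 : ContinuousAt (fun z => (g.coeffMatrix e z).det) y :=
    (continuous_id.matrix_det).continuousAt.comp hG
  have h2 : ContinuousAt (fun z => (g.coeffMatrix e z).adjugate) y :=
    (continuous_id.matrix_adjugate).continuousAt.comp hG
  exact (h1.inv₀ (isUnit_det_coeffMatrix he hy).ne_zero).smul h2

theorem continuousAt_christoffel (he : IsSmoothChart e) {y : Coord d} (hy : y ∈ e.target)
    (hg : ∀ μ ν, ContDiffAt ℝ 1 (g.coeff e μ ν) y) (μ ρ σ : Fin (d + 1)) :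
    ContinuousAt (g.christoffel e μ ρ σ) y := by
  have hd : ∀ κ μ ν, ContinuousAt (g.dCoeff e κ μ ν) y := fun κ μ ν =>
    (((hg μ ν).fderiv_right (m := 0) (by simp)).clm_apply contDiffAt_const).continuousAt
  have hi := continuousAt_inv_coeffMatrix he hy fun μ ν => (hg μ ν).continuousAt
  have hinv : ∀ μ ν, ContinuousAt (fun z => (g.coeffMatrix e z)⁻¹ μ ν) y := fun μ ν =>
    continuousAt_pi.1 (continuousAt_pi.1 hi μ) ν
  refine ContinuousAt.mul continuousAt_const (tendsto_finsetSum _ fun ν _ => ?_)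
  exact (hinv μ ν).mul (((hd _ _ _).add (hd _ _ _)).sub (hd _ _ _))

end Regularity

end LorentzianMetric

/-! ### Orthonormal frames and their parallel transport -/

theorem norm_le_sum_abs {d : ℕ} (u : Coord d) : ‖u‖ ≤ ∑ μ, |u μ| := by
  conv_lhs => rw [← sum_smul_single u]
  refine (norm_sum_le _ _).trans (Finset.sum_le_sum fun μ _ => ?_)
  rw [norm_smul, PiLp.norm_single, norm_one, mul_one, Real.norm_eq_abs]

theorem sqrt_sum_sq_le_sum_abs {n : Type*} [Fintype n] (c : n → ℝ) :
    √(∑ α, c α ^ 2) ≤ ∑ α, |c α| := by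
  refine Real.sqrt_le_iff.2 ⟨Finset.sum_nonneg fun _ _ => abs_nonneg _, ?_⟩
  simpa only [sq_abs] using
    Finset.sum_sq_le_sq_sum_of_nonneg (s := Finset.univ) (f := fun α => |c α|)
      fun _ _ => abs_nonneg _

/-- The operator norm of a matrix is controlled by its entries. -/
theorem exists_norm_toEuclideanCLM_le (n : Type*) [Fintype n] [DecidableEq n] :
    ∃ C : ℝ, ∀ (k : ℝ) (L : Matrix n n ℝ), (∀ i j, |L i j| ≤ k) →
      ‖Matrix.toEuclideanCLM (𝕜 := ℝ) L‖ ≤ C * k := by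
  refine ⟨∑ i, ∑ j, ‖Matrix.toEuclideanCLM (𝕜 := ℝ) (Matrix.single i j (1 : ℝ) : Matrix n n ℝ)‖,
    fun k L hL => ?_⟩
  have h : Matrix.toEuclideanCLM (𝕜 := ℝ) L =
      ∑ i, ∑ j, L i j • Matrix.toEuclideanCLM (𝕜 := ℝ) (Matrix.single i j (1 : ℝ)) := by
    conv_lhs => rw [Matrix.matrix_eq_sum_single L]
    simp only [map_sum, ← map_smul, Matrix.smul_single, smul_eq_mul, mul_one]
  rw [h, Finset.sum_mul]
  refine (norm_sum_le _ _).trans (Finset.sum_le_sum fun i _ => ?_)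
  rw [Finset.sum_mul]
  refine (norm_sum_le _ _).trans (Finset.sum_le_sum fun j _ => ?_)
  rw [norm_smul, mul_comm]
  exact mul_le_mul_of_nonneg_left (hL i j) (norm_nonneg _)

namespace LorentzianMetric

variable {d : ℕ} {M : Type*} [TopologicalSpace M] [ChartedSpace (Coord d) M]
  {g : LorentzianMetric d M} {e : OpenPartialHomeomorph M (Coord d)}

theorem abs_minkowskiMatrix_diag (α : Fin (d + 1)) : |minkowskiMatrix d α α| = 1 := by
  rw [minkowskiMatrix, Matrix.diagonal_apply_eq]
  split_ifs <;> norm_num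

theorem sum_mul_minkowskiMatrix (c : Fin (d + 1) → ℝ) (β : Fin (d + 1)) :
    ∑ α, c α * minkowskiMatrix d β α = c β * minkowskiMatrix d β β := by
  rw [Finset.sum_eq_single β]
  · intro α _ h
    rw [minkowskiMatrix, Matrix.diagonal_apply_ne _ h.symm, mul_zero]
  · simp

/-- The components of a vector in an orthonormal basis are, up to sign, its products with the
basis vectors. -/
theorem abs_repr_eq_abs_form {x : M}
    (b : Module.Basis (Fin (d + 1)) ℝ (TangentSpace (𝓡 (d + 1)) x))
    (hb : ∀ α β, g.form x (b α) (b β) = minkowskiMatrix d α β)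
    (v : TangentSpace (𝓡 (d + 1)) x) (β : Fin (d + 1)) :
    |b.repr v β| = |g.form x (b β) v| := by
  have h : g.form x (b β) v = b.repr v β * minkowskiMatrix d β β := by
    conv_lhs => rw [← b.sum_repr v]
    simp only [map_sum, map_smul, smul_eq_mul, hb]
    exact sum_mul_minkowskiMatrix _ _
  rw [h, abs_mul, abs_minkowskiMatrix_diag, mul_one]

/-- The matrix comparing two orthonormal families is a Lorentz transformation. -/
theorem isLorentzMatrix_repr {x : M}
    (b : Module.Basis (Fin (d + 1)) ℝ (TangentSpace (𝓡 (d + 1)) x))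
    (hb : ∀ α β, g.form x (b α) (b β) = minkowskiMatrix d α β)
    (v : Fin (d + 1) → TangentSpace (𝓡 (d + 1)) x)
    (hv : ∀ α β, g.form x (v α) (v β) = minkowskiMatrix d α β) :
    IsLorentzMatrix d (Matrix.of fun α β => b.repr (v α) β) := by
  ext α β
  rw [← hv α β]
  conv_rhs => rw [← b.sum_repr (v α), ← b.sum_repr (v β)]
  simp only [map_sum, LinearMap.sum_apply, map_smul, LinearMap.smul_apply, smul_eq_mul, hb,
    Matrix.mul_apply, Matrix.transpose_apply, Matrix.of_apply]
  refine Finset.sum_congr rfl fun i _ => ?_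
  rw [mul_comm]

/-- An orthonormal family in coordinates is a basis. -/
theorem exists_basis_of_bilin {y : Coord d} (b : Fin (d + 1) → Coord d)
    (hb : ∀ α β, g.bilin e y (b α) (b β) = minkowskiMatrix d α β) :
    ∃ B : Module.Basis (Fin (d + 1)) ℝ (Coord d), ∀ α, B α = b α := by
  have hlin : LinearIndependent ℝ b := by
    rw [Fintype.linearIndependent_iff]
    intro c hc β
    have h1 : ∀ s : Finset (Fin (d + 1)), g.bilin e y (b β) (∑ α ∈ s, c α • b α) =
        ∑ α ∈ s, c α * minkowskiMatrix d β α := by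
      intro s
      induction s using Finset.induction_on with
      | empty => simp [bilin]
      | insert a s ha ih =>
        rw [Finset.sum_insert ha, Finset.sum_insert ha, bilin_add_right, ih, bilin_smul_right, hb]
    have h2 := h1 Finset.univ
    rw [hc, sum_mul_minkowskiMatrix] at h2
    have h3 : c β * minkowskiMatrix d β β = 0 := by
      rw [← h2]
      simp [bilin]
    refine (mul_eq_zero.1 h3).resolve_right fun h => ?_
    have := abs_minkowskiMatrix_diag β
    rw [h, abs_zero] at this
    exact zero_ne_one this
  refine ⟨basisOfLinearIndependentOfCardEqFinrank hlin (by simp), fun α => ?_⟩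
  simp

/-- The matrix of the linear map `u ↦ Γ(a, u)`. -/
def christoffelMatrix (g : LorentzianMetric d M) (e : OpenPartialHomeomorph M (Coord d))
    (y a : Coord d) : Matrix (Fin (d + 1)) (Fin (d + 1)) ℝ :=
  Matrix.of fun μ σ => ∑ ρ, g.christoffel e μ ρ σ y * a ρ

theorem toEuclideanCLM_christoffelMatrix (y a u : Coord d) :
    Matrix.toEuclideanCLM (𝕜 := ℝ) (g.christoffelMatrix e y a) u = g.christoffelMap e y a u := by
  ext μ
  rw [Matrix.ofLp_toEuclideanCLM, christoffelMap_apply]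
  simp only [christoffelMatrix, Matrix.mulVec, dotProduct, Matrix.of_apply, Finset.sum_mul]
  exact Finset.sum_comm

/-- The components of a parallel field satisfy the parallel transport equation. -/
theorem IsParallel.hasDerivWithinAt {γ : ℝ → M} {S : Set ℝ}
    {X : ∀ t : ℝ, TangentSpace (𝓡 (d + 1)) (γ t)} (hX : g.IsParallel γ S X) (he : IsSmoothChart e)
    {t : ℝ} (ht : t ∈ S) (hx : γ t ∈ e.source) :
    HasDerivWithinAt (fun s => inCoord e (γ s) (X s))
      (-g.christoffelMap e (e (γ t)) (inCoord e (γ t) (velocity d γ S t)) (inCoord e (γ t) (X t)))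
      S t :=
  hX e he t ht hx

/-- An orthonormal basis can be transported in parallel along a curve inside a chart. The
parallel transport equation is linear; its solvability on the interval `S` is assumed. -/
theorem exists_parallelFrame (he : IsSmoothChart e) {γ : ℝ → M} {S : Set ℝ} {a : ℝ}
    (hS : Convex ℝ S) (hSd : UniqueDiffOn ℝ S) (ha : a ∈ S)
    (hode : ∀ B : ℝ → Coord d →L[ℝ] Coord d, ContinuousOn B S → ∀ x₀ : Coord d,
      ∃ X : ℝ → Coord d, X a = x₀ ∧ ∀ t ∈ S, HasDerivWithinAt X (B t (X t)) S t)
    (hγ : ContMDiffOn 𝓘(ℝ) (𝓡 (d + 1)) 1 γ S) (hsrc : ∀ t ∈ S, γ t ∈ e.source)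
    (hg : ∀ e' : OpenPartialHomeomorph M (Coord d), IsSmoothChart e' → ∀ t ∈ S, γ t ∈ e'.source →
      ∀ μ ν, ContDiffAt ℝ 1 (g.coeff e' μ ν) (e' (γ t)))
    (b : Fin (d + 1) → Coord d)
    (hb : ∀ α β, g.bilin e (e (γ a)) (b α) (b β) = minkowskiMatrix d α β) :
    ∃ E : FrameAlong d γ, g.IsParallelFrame γ S E ∧ ∀ α, inCoord e (γ a) (E a α) = b α := by
  have hγd : ∀ t ∈ S, MDifferentiableWithinAt 𝓘(ℝ) (𝓡 (d + 1)) γ S t :=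
    hγ.mdifferentiableOn (by simp)
  have hy : ∀ t ∈ S, HasDerivWithinAt (fun s => e (γ s)) (inCoord e (γ t) (velocity d γ S t)) S t :=
    fun t ht => hasDerivWithinAt_coord he (hγd t ht) (hsrc t ht)
  have hv := continuousOn_inCoord_velocity he hSd hγ hsrc
  set y' : ℝ → Coord d := fun t => inCoord e (γ t) (velocity d γ S t)
  have hmat : ContinuousOn (fun t => g.christoffelMatrix e (e (γ t)) (y' t)) S := by
    suffices h : ∀ μ σ, ContinuousOn (fun t => g.christoffelMatrix e (e (γ t)) (y' t) μ σ) S from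
      continuousOn_pi.2 fun μ => continuousOn_pi.2 fun σ => h μ σ
    intro μ σ
    simp only [christoffelMatrix, Matrix.of_apply]
    refine continuousOn_finsetSum _ fun ρ _ t ht => ContinuousWithinAt.mul ?_ ?_
    · exact ContinuousAt.comp_continuousWithinAt (f := fun s => e (γ s))
        (continuousAt_christoffel he (e.map_source (hsrc t ht)) (hg e he t ht (hsrc t ht))
          μ ρ σ) (hy t ht).continuousWithinAt
    · exact ((EuclideanSpace.proj (𝕜 := ℝ) ρ).continuous.comp_continuousOn hv) t ht
  have hCLM : Continuous fun L : Matrix (Fin (d + 1)) (Fin (d + 1)) ℝ =>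
      Matrix.toEuclideanCLM (𝕜 := ℝ) L :=
    LinearMap.continuous_of_finiteDimensional
      ((Matrix.toEuclideanCLM (𝕜 := ℝ) (n := Fin (d + 1))).toAlgEquiv.toLinearMap)
  choose X hX0 hX using fun α => hode
    (fun t => -Matrix.toEuclideanCLM (𝕜 := ℝ) (g.christoffelMatrix e (e (γ t)) (y' t)))
    (hCLM.comp_continuousOn hmat).neg (b α)
  simp only [neg_apply, toEuclideanCLM_christoffelMatrix] at hX
  have horth : ∀ t ∈ S, ∀ α β,
      g.bilin e (e (γ t)) (X α t) (X β t) = minkowskiMatrix d α β := by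
    intro t ht α β
    have hder : ∀ s ∈ S, HasDerivWithinAt (fun s => g.bilin e (e (γ s)) (X α s) (X β s)) 0 S s := by
      intro s hs
      refine (hasDerivWithinAt_bilin (fun μ ν => (hg e he s hs (hsrc s hs) μ ν).differentiableAt
        (by simp)) (hy s hs) (hX α s hs) (hX β s hs)).congr_deriv ?_
      rw [dBilin_eq_add he (e.map_source (hsrc s hs)), bilin_neg_right, bilin_neg_left]
      ring
    have h := hS.norm_image_sub_le_of_norm_hasDerivWithin_le (C := 0) hder (by simp) ha ht
    rw [zero_mul] at h
    have h2 := sub_eq_zero.1 (norm_le_zero_iff.1 h)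
    simp only [hX0] at h2
    rw [h2, hb]
  have hbasis : ∀ t, ∃ B : Module.Basis (Fin (d + 1)) ℝ (TangentSpace (𝓡 (d + 1)) (γ t)),
      t ∈ S → ∀ α, inCoord e (γ t) (B α) = X α t := by
    intro t
    by_cases ht : t ∈ S
    · obtain ⟨B, hB⟩ := exists_basis_of_bilin (fun α => X α t) (horth t ht)
      refine ⟨B.map (inCoordEquiv he (hsrc t ht)).symm, fun _ α => ?_⟩
      rw [Module.Basis.map_apply, ← inCoordEquiv_apply he (hsrc t ht),
        LinearEquiv.apply_symm_apply, hB]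
    · obtain ⟨B, -⟩ := g.exists_orthonormal (γ t)
      exact ⟨B, fun h => absurd h ht⟩
  choose E hE using hbasis
  refine ⟨E, ⟨fun t ht α β => ?_, fun α => ?_⟩, fun α => ?_⟩
  · rw [form_eq_bilin he (hsrc t ht), hE t ht, hE t ht, horth t ht]
  · refine isParallel_of_chart he hγd hsrc (fun e' he' t ht hx μ ν =>
      (hg e' he' t ht hx μ ν).differentiableAt (by simp)) fun t ht => ?_
    rw [hE t ht]
    exact (hX α t ht).congr (fun s hs => hE s hs α) (hE t ht α)
  · rw [hE a ha, hX0]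

end LorentzianMetric

/-! ### Bounds near a point of a locally Lipschitz metric -/

namespace LorentzianMetric

variable {d : ℕ} {M : Type*} [TopologicalSpace M] [ChartedSpace (Coord d) M]
  {g : LorentzianMetric d M} {e : OpenPartialHomeomorph M (Coord d)}

theorem abs_sum_sum_mul_le {n : Type*} [Fintype n] (c : n → n → ℝ) (u v : EuclideanSpace ℝ n) :
    |∑ μ, ∑ ν, c μ ν * u μ * v ν| ≤ (∑ μ, ∑ ν, |c μ ν|) * ‖u‖ * ‖v‖ := by
  rw [Finset.sum_mul, Finset.sum_mul]
  refine (Finset.abs_sum_le_sum_abs _ _).trans (Finset.sum_le_sum fun μ _ => ?_)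
  rw [Finset.sum_mul, Finset.sum_mul]
  refine (Finset.abs_sum_le_sum_abs _ _).trans (Finset.sum_le_sum fun ν _ => ?_)
  rw [abs_mul, abs_mul]
  have hu : |u μ| ≤ ‖u‖ := PiLp.norm_apply_le u μ
  have hv : |v ν| ≤ ‖v‖ := PiLp.norm_apply_le v ν
  gcongr

theorem continuousAt_coeff (hg : g.IsLocallyLipschitz) (he : IsSmoothChart e) {y₀ : Coord d}
    (hy₀ : y₀ ∈ e.target) (μ ν : Fin (d + 1)) : ContinuousAt (g.coeff e μ ν) y₀ :=
  (hg e he μ ν).continuousOn.continuousAt (e.open_target.mem_nhds hy₀)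

/-- The Christoffel symbols of a locally Lipschitz metric are locally bounded. -/
theorem christoffel_isBigO_one (hg : g.IsLocallyLipschitz) (he : IsSmoothChart e) {y₀ : Coord d}
    (hy₀ : y₀ ∈ e.target) (μ ρ σ : Fin (d + 1)) :
    g.christoffel e μ ρ σ =O[𝓝 y₀] fun _ => (1 : ℝ) := by
  have hnhds := e.open_target.mem_nhds hy₀
  have hd : ∀ κ μ ν, g.dCoeff e κ μ ν =O[𝓝 y₀] fun _ => (1 : ℝ) := fun κ μ ν => by
    obtain ⟨K, t, ht, hK⟩ := hg e he μ ν hy₀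
    rw [nhdsWithin_eq_nhds.2 hnhds] at ht
    refine Asymptotics.IsBigO.of_bound K ?_
    filter_upwards [eventually_mem_nhds_iff.2 ht] with y hy
    have h1 := norm_fderiv_le_of_lipschitzOn ℝ hy hK
    have h2 := (fderiv ℝ (g.coeff e μ ν) y).le_of_opNorm_le h1 (EuclideanSpace.single κ (1 : ℝ))
    simpa [dCoeff] using h2
  have hinv : ∀ μ ν, (fun z => (g.coeffMatrix e z)⁻¹ μ ν) =O[𝓝 y₀] fun _ => (1 : ℝ) := fun μ ν =>
    (continuousAt_pi.1 (continuousAt_pi.1 (continuousAt_inv_coeffMatrix he hy₀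
      fun μ ν => continuousAt_coeff hg he hy₀ μ ν) μ) ν).tendsto.isBigO_one ℝ
  refine Asymptotics.IsBigO.const_mul_left (Asymptotics.IsBigO.fun_sum fun ν _ => ?_) _
  have h := (hinv μ ν).mul (((hd ρ ν σ).add (hd σ ν ρ)).sub (hd ν ρ σ))
  simp only [mul_one] at h
  exact h

theorem exists_eventually_abs_bilin_le (hg : g.IsLocallyLipschitz) (he : IsSmoothChart e)
    {y₀ : Coord d} (hy₀ : y₀ ∈ e.target) :
    ∃ K : ℝ, ∀ᶠ y in 𝓝 y₀, ∀ u v, |g.bilin e y u v| ≤ K * ‖u‖ * ‖v‖ := by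
  have h : (fun y => ∑ μ, ∑ ν, |g.coeff e μ ν y|) =O[𝓝 y₀] fun _ => (1 : ℝ) :=
    Asymptotics.IsBigO.fun_sum fun μ _ => Asymptotics.IsBigO.fun_sum fun ν _ =>
      ((continuousAt_coeff hg he hy₀ μ ν).tendsto.isBigO_one ℝ).norm_left
  obtain ⟨K, hK⟩ := h.bound
  refine ⟨K, hK.mono fun y hy u v => (abs_sum_sum_mul_le (fun μ ν => g.coeff e μ ν y) u v).trans ?_⟩
  have h2 : ∑ μ, ∑ ν, |g.coeff e μ ν y| ≤ K := by
    simpa using (le_abs_self _).trans hy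
  gcongr

theorem exists_eventually_norm_christoffelMap_le (hg : g.IsLocallyLipschitz)
    (he : IsSmoothChart e) {y₀ : Coord d} (hy₀ : y₀ ∈ e.target) :
    ∃ K : ℝ, ∀ᶠ y in 𝓝 y₀, ∀ u v, ‖g.christoffelMap e y u v‖ ≤ K * ‖u‖ * ‖v‖ := by
  have h : (fun y => ∑ μ, ∑ ρ, ∑ σ, |g.christoffel e μ ρ σ y|) =O[𝓝 y₀] fun _ => (1 : ℝ) :=
    Asymptotics.IsBigO.fun_sum fun μ _ => Asymptotics.IsBigO.fun_sum fun ρ _ =>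
      Asymptotics.IsBigO.fun_sum fun σ _ => (christoffel_isBigO_one hg he hy₀ μ ρ σ).norm_left
  obtain ⟨K, hK⟩ := h.bound
  refine ⟨K, hK.mono fun y hy u v => ?_⟩
  have h2 : ∑ μ, ∑ ρ, ∑ σ, |g.christoffel e μ ρ σ y| ≤ K := by
    simpa using (le_abs_self _).trans hy
  calc ‖g.christoffelMap e y u v‖ ≤ ∑ μ, |g.christoffelMap e y u v μ| := norm_le_sum_abs _
    _ ≤ ∑ μ, (∑ ρ, ∑ σ, |g.christoffel e μ ρ σ y|) * ‖u‖ * ‖v‖ :=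
        Finset.sum_le_sum fun μ _ => abs_sum_sum_mul_le (fun ρ σ => g.christoffel e μ ρ σ y) u v
    _ = (∑ μ, ∑ ρ, ∑ σ, |g.christoffel e μ ρ σ y|) * ‖u‖ * ‖v‖ := by
        rw [← Finset.sum_mul, ← Finset.sum_mul]
    _ ≤ K * ‖u‖ * ‖v‖ := by gcongr

theorem bilin_self_eq_of_orthonormal {y : Coord d} (b : Module.Basis (Fin (d + 1)) ℝ (Coord d))
    (hb : ∀ α β, g.bilin e y (b α) (b β) = minkowskiMatrix d α β) (v : Coord d) :
    g.bilin e y v v = ∑ α, b.repr v α ^ 2 - 2 * b.repr v 0 ^ 2 := by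
  have h1 : ∀ (u : Coord d) (s : Finset (Fin (d + 1))), g.bilin e y u (∑ α ∈ s, b.repr v α • b α) =
      ∑ α ∈ s, b.repr v α * g.bilin e y u (b α) := by
    intro u s
    induction s using Finset.induction_on with
    | empty => simp [bilin]
    | insert a s ha ih =>
      rw [Finset.sum_insert ha, Finset.sum_insert ha, bilin_add_right, ih, bilin_smul_right]
  have h2 : ∀ u, g.bilin e y u v = ∑ α, b.repr v α * g.bilin e y u (b α) := fun u => by
    rw [← h1 u Finset.univ, b.sum_repr]
  have h3 : ∀ α, g.bilin e y v (b α) = b.repr v α * minkowskiMatrix d α α := fun α => by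
    rw [bilin_symm, h2]
    simp only [hb]
    exact sum_mul_minkowskiMatrix _ _
  rw [h2 v]
  simp only [h3]
  rw [Fin.sum_univ_succ, Fin.sum_univ_succ]
  have h4 : ∀ i : Fin d, minkowskiMatrix d i.succ i.succ = 1 := fun i => by
    simp [minkowskiMatrix, Fin.succ_ne_zero]
  have h5 : minkowskiMatrix d 0 0 = -1 := by simp [minkowskiMatrix]
  simp only [h4, h5]
  have h6 : ∑ i : Fin d, b.repr v i.succ * (b.repr v i.succ * 1) =
      ∑ i : Fin d, b.repr v i.succ ^ 2 := Finset.sum_congr rfl fun i _ => by ring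
  rw [h6]
  ring

/-- Near a given point, all causal vectors are controlled by a single linear functional: the time
component with respect to a basis which is orthonormal at that point. -/
theorem exists_eventually_norm_le_of_causal (hg : g.IsLocallyLipschitz)
    (he : IsSmoothChart e) {y₀ : Coord d} (hy₀ : y₀ ∈ e.target) :
    ∃ (τ : Coord d →L[ℝ] ℝ) (C : ℝ), ∀ᶠ y in 𝓝 y₀, ∀ v, g.bilin e y v v ≤ 0 → ‖v‖ ≤ C * |τ v| := by
  obtain ⟨b, hb⟩ := exists_orthonormal_bilin (g := g) he hy₀
  set A : ℝ := ∑ α, ‖b α‖ ^ 2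
  have hA : 0 ≤ A := Finset.sum_nonneg fun _ _ => by positivity
  have hnorm : ∀ v, ‖v‖ ^ 2 ≤ A * ∑ α, b.repr v α ^ 2 := fun v => by
    have h1 : ‖v‖ ≤ ∑ α, ‖b α‖ * |b.repr v α| := by
      conv_lhs => rw [← b.sum_repr v]
      refine (norm_sum_le _ _).trans (Finset.sum_le_sum fun α _ => ?_)
      rw [norm_smul, mul_comm, Real.norm_eq_abs]
    calc ‖v‖ ^ 2 ≤ (∑ α, ‖b α‖ * |b.repr v α|) ^ 2 := by gcongr
      _ ≤ (∑ α, ‖b α‖ ^ 2) * ∑ α, |b.repr v α| ^ 2 := Finset.sum_mul_sq_le_sq_mul_sq _ _ _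
      _ = A * ∑ α, b.repr v α ^ 2 := by simp only [sq_abs, A]
  have hsmall : ∀ᶠ y in 𝓝 y₀,
      ∑ μ, ∑ ν, |g.coeff e μ ν y - g.coeff e μ ν y₀| < 1 / (2 * (A + 1)) := by
    have hc : ContinuousAt (fun y => ∑ μ, ∑ ν, |g.coeff e μ ν y - g.coeff e μ ν y₀|) y₀ :=
      tendsto_finsetSum _ fun μ _ => tendsto_finsetSum _ fun ν _ =>
        ((continuousAt_coeff hg he hy₀ μ ν).sub continuousAt_const).abs
    refine hc.eventually (gt_mem_nhds ?_)
    simp only [sub_self, abs_zero, Finset.sum_const_zero]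
    positivity
  refine ⟨LinearMap.toContinuousLinearMap (b.coord 0), √(4 * A), hsmall.mono fun y hy v hv => ?_⟩
  set N := ∑ α, b.repr v α ^ 2
  have hN : 0 ≤ N := Finset.sum_nonneg fun _ _ => sq_nonneg _
  have h1 : |g.bilin e y v v - g.bilin e y₀ v v| ≤ N / 2 := by
    have h2 : g.bilin e y v v - g.bilin e y₀ v v =
        ∑ μ, ∑ ν, (g.coeff e μ ν y - g.coeff e μ ν y₀) * v μ * v ν := by
      simp only [bilin, ← Finset.sum_sub_distrib, sub_mul]
    rw [h2]
    refine (abs_sum_sum_mul_le (fun μ ν => g.coeff e μ ν y - g.coeff e μ ν y₀) v v).trans ?_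
    rw [mul_assoc, ← sq]
    calc _ ≤ 1 / (2 * (A + 1)) * (A * N) :=
          mul_le_mul hy.le (hnorm v) (by positivity) (by positivity)
      _ ≤ 1 / (2 * (A + 1)) * ((A + 1) * N) := by gcongr; linarith
      _ = N / 2 := by field_simp
  rw [bilin_self_eq_of_orthonormal b hb v] at h1
  have h3 : N ≤ 4 * b.repr v 0 ^ 2 := by
    have := neg_le_of_abs_le h1
    linarith
  have h4 : ‖v‖ ^ 2 ≤ (√(4 * A) * |b.repr v 0|) ^ 2 := by
    rw [mul_pow, Real.sq_sqrt (by positivity), sq_abs]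
    have := hnorm v
    have := mul_le_mul_of_nonneg_left h3 hA
    linarith
  exact le_of_sq_le_sq h4 (by positivity)

end LorentzianMetric

/-! ### Curves running into a point -/

/-- If the velocity of a convergent curve is controlled by a nowhere vanishing linear functional of
the velocity, then, up to a factor, that functional of the curve is a bounded monotone function
whose derivative bounds the speed; in particular the curve has finite length. -/
theorem exists_clock {F : Type*} [NormedAddCommGroup F] [NormedSpace ℝ F] {a b : ℝ}
    {y y' : ℝ → F} {y₀ : F} (τ : F →L[ℝ] ℝ) (C : ℝ)
    (hy : ∀ t ∈ Ico a b, HasDerivWithinAt y (y' t) (Ico a b) t)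
    (hcont : ContinuousOn y' (Ico a b)) (hlim : Tendsto y (𝓝[<] b) (𝓝 y₀))
    (hle : ∀ t ∈ Ico a b, ‖y' t‖ ≤ C * |τ (y' t)|) (hne : ∀ t ∈ Ico a b, y' t ≠ 0) :
    (∃ (h h' : ℝ → ℝ) (B : ℝ), (∀ t ∈ Ico a b, HasDerivWithinAt h (h' t) (Ico a b) t) ∧
      (∀ t ∈ Ico a b, ‖y' t‖ ≤ h' t) ∧ ∀ t ∈ Ico a b, |h t| ≤ B) ∧
    ∫⁻ t in Ico a b, ENNReal.ofReal ‖y' t‖ < ⊤ := by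
  have hτne : ∀ t ∈ Ico a b, τ (y' t) ≠ 0 := fun t ht h0 => by
    have := hle t ht
    rw [h0, abs_zero, mul_zero] at this
    exact hne t ht (norm_le_zero_iff.1 this)
  have hτc : ContinuousOn (fun t => τ (y' t)) (Ico a b) := τ.continuous.comp_continuousOn hcont
  have hsign : ∃ s : ℝ, ∀ t ∈ Ico a b, |τ (y' t)| = s * τ (y' t) := by
    by_cases hpos : ∀ t ∈ Ico a b, 0 < τ (y' t)
    · exact ⟨1, fun t ht => by rw [abs_of_pos (hpos t ht), one_mul]⟩
    · push Not at hpos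
      obtain ⟨t₁, ht₁, h₁⟩ := hpos
      refine ⟨-1, fun t ht => ?_⟩
      rw [neg_one_mul, abs_of_nonpos]
      by_contra! h₂
      obtain ⟨t₀, ht₀, h₀⟩ := isPreconnected_Ico.intermediate_value ht₁ ht hτc ⟨h₁, h₂.le⟩
      exact hτne t₀ ht₀ h₀
  obtain ⟨s, hs⟩ := hsign
  set h : ℝ → ℝ := fun t => C * s * τ (y t)
  set h' : ℝ → ℝ := fun t => C * s * τ (y' t)
  have hh : ∀ t ∈ Ico a b, HasDerivWithinAt h (h' t) (Ico a b) t := fun t ht =>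
    (τ.hasFDerivAt.comp_hasDerivWithinAt t (hy t ht)).const_mul (C * s)
  have hh' : ∀ t ∈ Ico a b, ‖y' t‖ ≤ h' t := fun t ht => by
    have := hle t ht
    rwa [hs t ht, ← mul_assoc] at this
  have hcontb : ContinuousOn (Function.update h b (C * s * τ y₀)) (Icc a b) := by
    rw [continuousOn_update_iff, Icc_sdiff_right]
    refine ⟨fun t ht => (hh t ht).continuousWithinAt, fun _ => ?_⟩
    exact (((τ.continuous.tendsto y₀).comp hlim).const_mul (C * s)).mono_left
      (nhdsWithin_mono _ Ico_subset_Iio_self)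
  have hint : IntegrableOn h' (Ioc a b) := by
    refine intervalIntegral.integrableOn_deriv_of_nonneg hcontb (fun t ht => ?_) fun t ht =>
      (norm_nonneg _).trans (hh' t (Ioo_subset_Ico_self ht))
    have h1 := (hh t (Ioo_subset_Ico_self ht)).hasDerivAt (Ico_mem_nhds ht.1 ht.2)
    refine h1.congr_of_eventuallyEq ?_
    filter_upwards [Iio_mem_nhds ht.2] with r hr
    exact Function.update_of_ne (ne_of_lt hr) _ _
  refine ⟨⟨h, h', ?_⟩, ?_⟩
  · obtain ⟨B, hB⟩ := isCompact_Icc.exists_bound_of_continuousOn hcontb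
    refine ⟨B, hh, hh', fun t ht => ?_⟩
    have := hB t (Ico_subset_Icc_self ht)
    rwa [Function.update_of_ne ht.2.ne, Real.norm_eq_abs] at this
  · calc ∫⁻ t in Ico a b, ENNReal.ofReal ‖y' t‖
        ≤ ∫⁻ t in Ico a b, ENNReal.ofReal (h' t) :=
          setLIntegral_mono' measurableSet_Ico fun t ht => ENNReal.ofReal_le_ofReal (hh' t ht)
      _ = ∫⁻ t in Ioc a b, ENNReal.ofReal (h' t) := setLIntegral_congr Ico_ae_eq_Ioc
      _ < ⊤ := hint.lintegral_lt_top

namespace LorentzianMetric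

variable {d : ℕ} {M : Type*} [TopologicalSpace M] [ChartedSpace (Coord d) M]
  {g : LorentzianMetric d M} {e : OpenPartialHomeomorph M (Coord d)}

/-- The length element of gap-length is controlled by the coordinate speed and the size of the
components of the frame. -/
theorem sqrt_sum_repr_sq_le (he : IsSmoothChart e) {x : M} (hx : x ∈ e.source)
    (b : Module.Basis (Fin (d + 1)) ℝ (TangentSpace (𝓡 (d + 1)) x))
    (hb : ∀ α β, g.form x (b α) (b β) = minkowskiMatrix d α β) {K D : ℝ}
    (hK : ∀ u v, |g.bilin e (e x) u v| ≤ K * ‖u‖ * ‖v‖) (hK0 : 0 ≤ K)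
    (hD : ∀ α, ‖inCoord e x (b α)‖ ≤ D) (v : TangentSpace (𝓡 (d + 1)) x) :
    √(∑ α, (b.repr v α) ^ 2) ≤ (d + 1) * K * D * ‖inCoord e x v‖ := by
  refine (sqrt_sum_sq_le_sum_abs _).trans ?_
  have h : ∀ α, |b.repr v α| ≤ K * D * ‖inCoord e x v‖ := fun α => by
    rw [abs_repr_eq_abs_form b hb, form_eq_bilin he hx]
    refine (hK _ _).trans ?_
    have := hD α
    gcongr
  refine (Finset.sum_le_sum fun α _ => h α).trans (le_of_eq ?_)
  rw [Finset.sum_const, Finset.card_univ, Fintype.card_fin, nsmul_eq_mul]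
  push_cast
  ring

/-- The integrand of gap-length is continuous along a `C¹` curve. -/
theorem continuousOn_sqrt_sum_repr_sq (he : IsSmoothChart e) {γ : ℝ → M} {S : Set ℝ}
    (hS : UniqueDiffOn ℝ S) (hγ : ContMDiffOn 𝓘(ℝ) (𝓡 (d + 1)) 1 γ S)
    (hsrc : ∀ t ∈ S, γ t ∈ e.source) (hg : g.IsLocallyLipschitz) {E : FrameAlong d γ}
    (hE : g.IsParallelFrame γ S E) :
    ContinuousOn (fun t => √(∑ α, ((E t).repr (velocity d γ S t) α) ^ 2)) S := by
  have hv := continuousOn_inCoord_velocity he hS hγ hsrc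
  have hy : ContinuousOn (fun t => e (γ t)) S := fun t ht =>
    (hasDerivWithinAt_coord he (hγ.mdifferentiableOn (by simp) t ht)
      (hsrc t ht)).continuousWithinAt
  have hX : ∀ α, ContinuousOn (fun t => inCoord e (γ t) (E t α)) S := fun α t ht =>
    ((hE.2 α).hasDerivWithinAt he ht (hsrc t ht)).continuousWithinAt
  have happ : ∀ {w : ℝ → Coord d} (i : Fin (d + 1)), ContinuousOn w S →
      ContinuousOn (fun t => w t i) S := fun i hw =>
    (EuclideanSpace.proj (𝕜 := ℝ) i).continuous.comp_continuousOn hw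
  have hbil : ∀ α, ContinuousOn (fun t => g.bilin e (e (γ t)) (inCoord e (γ t) (E t α))
      (inCoord e (γ t) (velocity d γ S t))) S := fun α =>
    continuousOn_finsetSum _ fun μ _ => continuousOn_finsetSum _ fun ν _ =>
      ((((hg e he μ ν).continuousOn.comp hy fun t ht => e.map_source (hsrc t ht)).mul
        (happ μ (hX α))).mul (happ ν hv))
  refine (continuousOn_finsetSum Finset.univ fun α _ => (hbil α).pow 2).sqrt.congr fun t ht => ?_
  simp only
  congr 1
  refine Finset.sum_congr rfl fun α _ => ?_
  rw [← sq_abs, abs_repr_eq_abs_form _ (hE.1 t ht), form_eq_bilin he (hsrc t ht), sq_abs]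
  rfl

/-- The components of a parallel field grow at most exponentially in the length of the curve. -/
theorem norm_inCoord_le_of_isParallel (he : IsSmoothChart e) {γ : ℝ → M} {S S' : Set ℝ}
    (hS' : Convex ℝ S') (hsub : S' ⊆ S) (hsrc : ∀ t ∈ S', γ t ∈ e.source)
    {K : ℝ} (hK0 : 0 ≤ K) (hK : ∀ t ∈ S', ∀ u v,
      ‖g.christoffelMap e (e (γ t)) u v‖ ≤ K * ‖u‖ * ‖v‖)
    {h h' : ℝ → ℝ} (hh : ∀ t ∈ S', HasDerivWithinAt h (h' t) S' t)
    (hle : ∀ t ∈ S', ‖inCoord e (γ t) (velocity d γ S t)‖ ≤ h' t)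
    {X : ∀ t : ℝ, TangentSpace (𝓡 (d + 1)) (γ t)} (hX : g.IsParallel γ S X)
    {s t : ℝ} (hs : s ∈ S') (ht : t ∈ S') (hst : s ≤ t) :
    ‖inCoord e (γ t) (X t)‖ ≤ Real.exp (K * (h t - h s)) * ‖inCoord e (γ s) (X s)‖ := by
  rw [mul_sub]
  refine norm_le_exp_mul_norm hS' (X := fun t => inCoord e (γ t) (X t))
    (fun r hr => (hX.hasDerivWithinAt he (hsub hr) (hsrc r hr)).mono hsub)
    (τ := fun t => K * h t) (fun r hr => (hh r hr).const_mul K) (fun r hr => ?_) hs ht hst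
  rw [norm_neg]
  refine (hK r hr _ _).trans ?_
  have := hle r hr
  gcongr

end LorentzianMetric

namespace LorentzianMetric

variable {d : ℕ} {M : Type*} [TopologicalSpace M] [ChartedSpace (Coord d) M]
  {g : LorentzianMetric d M} {e : OpenPartialHomeomorph M (Coord d)}

/-- Near its end point a causal curve has finite coordinate length, and parallel frames along it
stay bounded. -/
theorem exists_bounds_near_end (hg : g.IsLocallyLipschitz) (he : IsSmoothChart e) {γ : ℝ → M}
    (hγ : ContMDiffOn 𝓘(ℝ) (𝓡 (d + 1)) 1 γ (Ico (-1) 0))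
    (hsrc : ∀ t ∈ Ico (-1 : ℝ) 0, γ t ∈ e.source)
    (hcausal : ∀ t ∈ Ico (-1 : ℝ) 0, g.IsCausal (γ t) (velocity d γ (Ico (-1) 0) t))
    {q : M} (hq : q ∈ e.source) (hlim : Tendsto γ (𝓝[<] 0) (𝓝 q)) :
    ∃ s₀ ∈ Ico (-1 : ℝ) 0,
      (∫⁻ t in Ico s₀ 0, ENNReal.ofReal ‖inCoord e (γ t) (velocity d γ (Ico (-1) 0) t)‖ < ⊤) ∧
      (∃ K : ℝ, 0 ≤ K ∧ ∀ t ∈ Ico s₀ 0, ∀ u v, |g.bilin e (e (γ t)) u v| ≤ K * ‖u‖ * ‖v‖) ∧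
      ∀ E : FrameAlong d γ, g.IsParallelFrame γ (Ico (-1) 0) E →
        ∃ D, ∀ t ∈ Ico s₀ 0, ∀ α, ‖inCoord e (γ t) (E t α)‖ ≤ D := by
  obtain ⟨τ, C, hC⟩ := exists_eventually_norm_le_of_causal hg he (e.map_source hq)
  obtain ⟨K₁, hK₁⟩ := exists_eventually_abs_bilin_le hg he (e.map_source hq)
  obtain ⟨K₂, hK₂⟩ := exists_eventually_norm_christoffelMap_le hg he (e.map_source hq)
  have hlime : Tendsto (fun t => e (γ t)) (𝓝[<] 0) (𝓝 (e q)) :=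
    (e.continuousAt hq).tendsto.comp hlim
  obtain ⟨s₀, hs₀, hnear⟩ : ∃ s₀ ∈ Ico (-1 : ℝ) 0, ∀ t ∈ Ico s₀ 0,
      (∀ v, g.bilin e (e (γ t)) v v ≤ 0 → ‖v‖ ≤ C * |τ v|) ∧
      (∀ u v, |g.bilin e (e (γ t)) u v| ≤ K₁ * ‖u‖ * ‖v‖) ∧
      ∀ u v, ‖g.christoffelMap e (e (γ t)) u v‖ ≤ K₂ * ‖u‖ * ‖v‖ := by
    have hev := hlime.eventually (hC.and (hK₁.and hK₂))
    obtain ⟨l, hl, hlev⟩ := mem_nhdsLT_iff_exists_Ico_subset.1 hev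
    refine ⟨max l (-1), ⟨le_max_right _ _, max_lt hl (by norm_num)⟩, fun t ht => hlev ?_⟩
    exact ⟨(le_max_left _ _).trans ht.1, ht.2⟩
  have hsub : Ico s₀ 0 ⊆ Ico (-1 : ℝ) 0 := Ico_subset_Ico_left hs₀.1
  have hv := continuousOn_inCoord_velocity he (uniqueDiffOn_Ico (-1 : ℝ) 0) hγ hsrc
  obtain ⟨⟨h, h', B, hh, hle, hB⟩, hlen⟩ := exists_clock τ C
    (y := fun t => e (γ t)) (y' := fun t => inCoord e (γ t) (velocity d γ (Ico (-1) 0) t))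
    (fun t ht => (hasDerivWithinAt_coord he (hγ.mdifferentiableOn (by simp) t (hsub ht))
      (hsrc t (hsub ht))).mono hsub) (hv.mono hsub) hlime
    (fun t ht => (hnear t ht).1 _ (by
      rw [← form_eq_bilin he (hsrc t (hsub ht))]
      exact (hcausal t (hsub ht)).1))
    (fun t ht h0 => (hcausal t (hsub ht)).2 (inCoord_injective he (hsrc t (hsub ht))
      (h0.trans (map_zero (mfderiv (𝓡 (d + 1)) (𝓡 (d + 1)) e (γ t))).symm)))
  refine ⟨s₀, hs₀, hlen, ⟨max K₁ 0, le_max_right _ _, fun t ht u v => ?_⟩, fun E hE => ?_⟩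
  · refine ((hnear t ht).2.1 u v).trans ?_
    have := le_max_left K₁ 0
    gcongr
  · refine ⟨Real.exp (max K₂ 0 * (B + B)) * ∑ α, ‖inCoord e (γ s₀) (E s₀ α)‖, fun t ht α => ?_⟩
    have hs : s₀ ∈ Ico s₀ 0 := left_mem_Ico.2 hs₀.2
    have h1 := norm_inCoord_le_of_isParallel he (convex_Ico s₀ 0) hsub
      (fun t ht => hsrc t (hsub ht)) (le_max_right K₂ 0) (fun t ht u v =>
        ((hnear t ht).2.2 u v).trans (by have := le_max_left K₂ 0; gcongr)) hh hle (hE.2 α) hs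
      ht ht.1
    refine h1.trans ?_
    have h2 : h t - h s₀ ≤ B + B := by
      have := (abs_le.1 (hB t ht)).2
      have := (abs_le.1 (hB s₀ hs)).1
      linarith
    have h3 : ‖inCoord e (γ s₀) (E s₀ α)‖ ≤ ∑ α, ‖inCoord e (γ s₀) (E s₀ α)‖ :=
      Finset.single_le_sum (f := fun α => ‖inCoord e (γ s₀) (E s₀ α)‖)
        (fun _ _ => norm_nonneg _) (Finset.mem_univ α)
    have := le_max_right K₂ 0
    gcongr

/-- A causal curve with an end point has finite gap-length. -/
theorem gapLength_lt_top (hg : g.IsLocallyLipschitz) (he : IsSmoothChart e) {γ : ℝ → M}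
    (hγ : ContMDiffOn 𝓘(ℝ) (𝓡 (d + 1)) 1 γ (Ico (-1) 0))
    (hsrc : ∀ t ∈ Ico (-1 : ℝ) 0, γ t ∈ e.source)
    (hcausal : ∀ t ∈ Ico (-1 : ℝ) 0, g.IsCausal (γ t) (velocity d γ (Ico (-1) 0) t))
    {q : M} (hq : q ∈ e.source) (hlim : Tendsto γ (𝓝[<] 0) (𝓝 q)) {E : FrameAlong d γ}
    (hE : g.IsParallelFrame γ (Ico (-1) 0) E) :
    gapLength d γ (Ico (-1) 0) E < ⊤ := by
  obtain ⟨s₀, hs₀, hlen, ⟨K, hK0, hK⟩, hD⟩ := exists_bounds_near_end hg he hγ hsrc hcausal hq hlim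
  obtain ⟨D, hD⟩ := hD E hE
  have hsub : Ico s₀ 0 ⊆ Ico (-1 : ℝ) 0 := Ico_subset_Ico_left hs₀.1
  have hcont := continuousOn_sqrt_sum_repr_sq he (uniqueDiffOn_Ico (-1 : ℝ) 0) hγ hsrc hg hE
  rw [gapLength, ← Ico_union_Ico_eq_Ico hs₀.1 hs₀.2.le]
  refine (lintegral_union_le _ _ _).trans_lt (ENNReal.add_lt_top.2 ⟨?_, ?_⟩)
  · obtain ⟨B, hB⟩ := isCompact_Icc.exists_bound_of_continuousOn
      (hcont.mono (Icc_subset_Ico_right hs₀.2))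
    rw [Ico_union_Ico_eq_Ico hs₀.1 hs₀.2.le]
    calc _ ≤ ∫⁻ _ in Ico (-1) s₀, ENNReal.ofReal B :=
          setLIntegral_mono' measurableSet_Ico fun t ht => ENNReal.ofReal_le_ofReal
            ((le_abs_self _).trans (hB t (Ico_subset_Icc_self ht)))
      _ < ⊤ := by
          rw [setLIntegral_const, Real.volume_Ico]
          exact ENNReal.mul_lt_top ENNReal.ofReal_lt_top ENNReal.ofReal_lt_top
  · rw [Ico_union_Ico_eq_Ico hs₀.1 hs₀.2.le]
    calc _ ≤ ∫⁻ t in Ico s₀ 0, ENNReal.ofReal ((d + 1) * K * D) *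
            ENNReal.ofReal ‖inCoord e (γ t) (velocity d γ (Ico (-1) 0) t)‖ := by
          refine setLIntegral_mono' measurableSet_Ico fun t ht => ?_
          rw [← ENNReal.ofReal_mul' (norm_nonneg _)]
          exact ENNReal.ofReal_le_ofReal (sqrt_sum_repr_sq_le he (hsrc t (hsub ht)) _
            (hE.1 t (hsub ht)) (hK t ht) hK0 (hD t ht) _)
      _ = ENNReal.ofReal ((d + 1) * K * D) *
            ∫⁻ t in Ico s₀ 0, ENNReal.ofReal ‖inCoord e (γ t) (velocity d γ (Ico (-1) 0) t)‖ :=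
          lintegral_const_mul' _ _ ENNReal.ofReal_ne_top
      _ < ⊤ := ENNReal.mul_lt_top ENNReal.ofReal_lt_top hlen

end LorentzianMetric

/-! ### Short curves below a Lipschitz graph -/

theorem convex_openCube (d : ℕ) (ε : ℝ) : Convex ℝ (openCube d ε) :=
  fun _ hx _ hy _ _ ha hb hab i => convex_Ioo (-ε) ε (hx i) (hy i) ha hb hab

theorem norm_spatialPart_sub_le {d : ℕ} (a b : Coord d) :
    ‖spatialPart b - spatialPart a‖ ≤ ‖b - a‖ := by
  rw [EuclideanSpace.norm_eq, EuclideanSpace.norm_eq]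
  refine Real.sqrt_le_sqrt ?_
  rw [Fin.sum_univ_succ]
  exact le_add_of_nonneg_left (sq_nonneg _)

/-- The chord from `a` to `b`, pushed down in the time direction by a parabola. -/
def saggingChord {d : ℕ} (a b : Coord d) (k t : ℝ) : Coord d :=
  a + t • (b - a) - (k * (t * (1 - t))) • (EuclideanSpace.single 0 (1 : ℝ) : Coord d)

theorem saggingChord_zero_apply {d : ℕ} (a b : Coord d) (k t : ℝ) :
    saggingChord a b k t 0 = (1 - t) * a 0 + t * b 0 - k * (t * (1 - t)) := by
  simp [saggingChord]
  ring

theorem spatialPart_saggingChord {d : ℕ} (a b : Coord d) (k t : ℝ) :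
    spatialPart (saggingChord a b k t) =
      spatialPart a + t • (spatialPart b - spatialPart a) := by
  ext i
  simp [saggingChord, spatialPart]

theorem hasDerivAt_saggingChord {d : ℕ} (a b : Coord d) (k t : ℝ) :
    HasDerivAt (saggingChord a b k)
      (b - a - (k * (1 - 2 * t)) • (EuclideanSpace.single 0 (1 : ℝ) : Coord d)) t := by
  have h1 : HasDerivAt (fun t : ℝ => a + t • (b - a)) (b - a) t :=
    (((hasDerivAt_id t).smul_const (b - a)).const_add a).congr_deriv (one_smul ℝ _)
  have h2 : HasDerivAt (fun t : ℝ => k * (t * (1 - t))) (k * (1 - 2 * t)) t :=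
    (((hasDerivAt_id t).mul ((hasDerivAt_id t).const_sub 1)).const_mul k).congr_deriv (by
      simp only [id]; ring)
  exact h1.sub (h2.smul_const _)

theorem contDiff_saggingChord {d : ℕ} (a b : Coord d) (k : ℝ) {n : ℕ∞ω} :
    ContDiff ℝ n (saggingChord a b k) :=
  (contDiff_const.add (contDiff_id.smul contDiff_const)).sub
    ((contDiff_const.mul (contDiff_id.mul (contDiff_const.sub contDiff_id))).smul contDiff_const)

/-- If the sag is at least twice the variation of a Lipschitz function `f` along the chord, then the
chord stays below the graph of `f` as soon as its end points do. -/
theorem saggingChord_lt {d : ℕ} {V : Set (EuclideanSpace ℝ (Fin d))} (hV : Convex ℝ V)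
    {f : EuclideanSpace ℝ (Fin d) → ℝ} {C : NNReal} (hf : LipschitzOnWith C f V) {a b : Coord d}
    (ha : spatialPart a ∈ V) (hb : spatialPart b ∈ V) (haf : a 0 < f (spatialPart a))
    (hbf : b 0 < f (spatialPart b)) {t : ℝ} (ht : t ∈ Icc (0 : ℝ) 1) :
    saggingChord a b (2 * C * ‖b - a‖) t 0 <
      f (spatialPart (saggingChord a b (2 * C * ‖b - a‖) t)) := by
  obtain ⟨ht0, ht1⟩ := ht
  rw [saggingChord_zero_apply, spatialPart_saggingChord]
  set z := spatialPart a + t • (spatialPart b - spatialPart a) with hz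
  have hzV : z ∈ V := hV.add_smul_sub_mem ha hb ⟨ht0, ht1⟩
  have hn := norm_spatialPart_sub_le a b
  have h1 : f (spatialPart a) - f z ≤ C * (t * ‖b - a‖) := by
    refine (le_abs_self _).trans ((hf.dist_le_mul _ ha _ hzV).trans ?_)
    have : dist (spatialPart a) z = t * ‖spatialPart b - spatialPart a‖ := by
      rw [dist_comm, dist_eq_norm, hz, add_sub_cancel_left, norm_smul, Real.norm_of_nonneg ht0]
    rw [this]
    gcongr
  have h2 : f (spatialPart b) - f z ≤ C * ((1 - t) * ‖b - a‖) := by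
    refine (le_abs_self _).trans ((hf.dist_le_mul _ hb _ hzV).trans ?_)
    have : dist (spatialPart b) z = (1 - t) * ‖spatialPart b - spatialPart a‖ := by
      have h3 : spatialPart b - z = (1 - t) • (spatialPart b - spatialPart a) := by
        rw [hz]
        module
      rw [dist_eq_norm, h3, norm_smul, Real.norm_of_nonneg (sub_nonneg.2 ht1)]
    rw [this]
    have := sub_nonneg.2 ht1
    gcongr
  -- Weighting the two Lipschitz bounds by `1 - t` and `t` gives the defect `2 C t (1 - t) ‖b - a‖`.
  have h3 := mul_le_mul_of_nonneg_left h1 (sub_nonneg.2 ht1)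
  have h4 := mul_le_mul_of_nonneg_left h2 ht0
  have h5 : (1 - t) * a 0 + t * b 0 < (1 - t) * f (spatialPart a) + t * f (spatialPart b) := by
    rcases ht0.eq_or_lt with rfl | ht0'
    · simpa using haf
    · exact add_lt_add_of_le_of_lt (mul_le_mul_of_nonneg_left haf.le (sub_nonneg.2 ht1))
        (mul_lt_mul_of_pos_left hbf ht0')
  nlinarith

/-- Two points below a Lipschitz graph and close to a given point are joined by a short curve below
the graph. -/
theorem exists_connecting_curve {d : ℕ} {M : Type*} [TopologicalSpace M]
    [ChartedSpace (Coord d) M] {e : OpenPartialHomeomorph M (Coord d)} (he : IsSmoothChart e)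
    {V : Set (EuclideanSpace ℝ (Fin d))} (hV : Convex ℝ V)
    (hVe : ∀ y ∈ e.target, spatialPart y ∈ V) {f : EuclideanSpace ℝ (Fin d) → ℝ} {C : NNReal}
    (hf : LipschitzOnWith C f V) {y₀ : Coord d} {R r : ℝ} (hR : Metric.ball y₀ R ⊆ e.target)
    {x₁ x₂ : M} (hx₁ : x₁ ∈ belowGraph e f) (hx₂ : x₂ ∈ belowGraph e f)
    (hr₁ : ‖e x₁ - y₀‖ ≤ r) (hr₂ : ‖e x₂ - y₀‖ ≤ r) (hrR : (1 + 4 * C) * r < R) :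
    ∃ σ : ℝ → M, ContMDiffOn 𝓘(ℝ) (𝓡 (d + 1)) 1 σ (Icc 0 1) ∧
      MapsTo σ (Icc 0 1) (belowGraph e f) ∧ σ 0 = x₁ ∧ σ 1 = x₂ ∧
      ∀ t ∈ Icc (0 : ℝ) 1, e (σ t) ∈ Metric.ball y₀ R ∧
        ‖inCoord e (σ t) (velocity d σ (Icc 0 1) t)‖ ≤ (2 + 4 * C) * r := by
  set a := e x₁
  set b := e x₂
  set k : ℝ := 2 * C * ‖b - a‖
  have hr : 0 ≤ r := (norm_nonneg _).trans hr₁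
  have hab : ‖b - a‖ ≤ 2 * r := by
    have : b - a = (b - y₀) - (a - y₀) := by abel
    rw [this]
    refine (norm_sub_le _ _).trans ?_
    linarith
  have hC : (0 : ℝ) ≤ C := C.2
  have hk0 : 0 ≤ k := by positivity
  have hk : k ≤ 4 * C * r := by
    have := mul_le_mul_of_nonneg_left hab (mul_nonneg zero_le_two hC)
    simp only [k]
    linarith
  have hnear : ∀ t ∈ Icc (0 : ℝ) 1, saggingChord a b k t ∈ Metric.ball y₀ R := by
    intro t ht
    have h1 : saggingChord a b k t - y₀ = (1 - t) • (a - y₀) + t • (b - y₀) -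
        (k * (t * (1 - t))) • (EuclideanSpace.single 0 (1 : ℝ) : Coord d) := by
      rw [saggingChord]
      module
    have ht' : 0 ≤ 1 - t := sub_nonneg.2 ht.2
    have h2 : t * (1 - t) ≤ 1 := by nlinarith [ht.1]
    have h3 : 0 ≤ t * (1 - t) := mul_nonneg ht.1 ht'
    rw [mem_ball_iff_norm, h1]
    refine lt_of_le_of_lt ?_ hrR
    refine (norm_sub_le _ _).trans ?_
    refine (add_le_add_left (norm_add_le _ _) _).trans ?_
    rw [norm_smul, norm_smul, norm_smul, PiLp.norm_single, norm_one, mul_one,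
      Real.norm_of_nonneg ht', Real.norm_of_nonneg ht.1, Real.norm_of_nonneg (by positivity)]
    have h4 := mul_le_mul_of_nonneg_left hr₁ ht'
    have h5 := mul_le_mul_of_nonneg_left hr₂ ht.1
    have h6 := mul_le_mul_of_nonneg_left h2 hk0
    linarith
  have htarget : ∀ t ∈ Icc (0 : ℝ) 1, saggingChord a b k t ∈ e.target := fun t ht => hR (hnear t ht)
  set σ : ℝ → M := fun t => e.symm (saggingChord a b k t)
  have heσ : ∀ t ∈ Icc (0 : ℝ) 1, e (σ t) = saggingChord a b k t := fun t ht =>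
    e.right_inv (htarget t ht)
  have hsrc : ∀ t ∈ Icc (0 : ℝ) 1, σ t ∈ e.source := fun t ht => e.map_target (htarget t ht)
  have hσ : ContMDiffOn 𝓘(ℝ) (𝓡 (d + 1)) 1 σ (Icc 0 1) :=
    ((contMDiffOn_symm_of_mem_maximalAtlas he).of_le (by simp)).comp
      (contDiff_saggingChord a b k).contMDiff.contMDiffOn htarget
  refine ⟨σ, hσ, fun t ht => ⟨hsrc t ht, ?_⟩, ?_, ?_, fun t ht => ⟨?_, ?_⟩⟩
  · rw [heσ t ht]
    exact saggingChord_lt hV hf (hVe _ (e.map_source hx₁.1)) (hVe _ (e.map_source hx₂.1)) hx₁.2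
      hx₂.2 ht
  · simp [σ, saggingChord, a, e.left_inv hx₁.1]
  · simp [σ, saggingChord, b, e.left_inv hx₂.1]
  · rw [heσ t ht]
    exact hnear t ht
  · have h1 := hasDerivWithinAt_coord he (hσ.mdifferentiableOn (by simp) t ht) (hsrc t ht)
    have h2 := ((hasDerivAt_saggingChord a b k t).hasDerivWithinAt (s := Icc 0 1)).congr heσ
      (heσ t ht)
    have h3 := (uniqueDiffOn_Icc (zero_lt_one' ℝ) t ht).eq_deriv _ h1 h2
    rw [h3]
    refine (norm_sub_le _ _).trans ?_
    rw [norm_smul, PiLp.norm_single, norm_one, mul_one, norm_mul, Real.norm_of_nonneg hk0]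
    have h4 : ‖1 - 2 * t‖ ≤ 1 := abs_le.2 ⟨by linarith [ht.2], by linarith [ht.1]⟩
    have h5 := mul_le_mul_of_nonneg_left h4 hk0
    linarith

/-! ### Comparison of the two curves -/

section Comparison

variable {d : ℕ} {M M' : Type*} [TopologicalSpace M] [ChartedSpace (Coord d) M]
  [TopologicalSpace M'] [ChartedSpace (Coord d) M']

/-- An isometric map sends future directed causal curves to causal curves. -/
theorem isCausal_comp {g : LorentzianMetric d M} {g' : LorentzianMetric d M'} {ι : M → M'}
    {T : ∀ x : M, TangentSpace (𝓡 (d + 1)) x}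
    (hι : ∀ x, MDifferentiableAt (𝓡 (d + 1)) (𝓡 (d + 1)) ι x)
    (hiso : ∀ x (v w : TangentSpace (𝓡 (d + 1)) x),
      g'.form (ι x) (mfderiv (𝓡 (d + 1)) (𝓡 (d + 1)) ι x v)
        (mfderiv (𝓡 (d + 1)) (𝓡 (d + 1)) ι x w) = g.form x v w)
    {γ : ℝ → M} {S : Set ℝ} (hS : UniqueDiffOn ℝ S) (hγ : g.IsFutureCausalC1Curve T γ S)
    {t : ℝ} (ht : t ∈ S) : g'.IsCausal (ι (γ t)) (velocity d (ι ∘ γ) S t) := by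
  have hv : velocity d (ι ∘ γ) S t =
      mfderiv (𝓡 (d + 1)) (𝓡 (d + 1)) ι (γ t) (velocity d γ S t) := by
    have h := mfderiv_comp_mfderivWithin t (hι (γ t)) (hγ.1.mdifferentiableOn (by simp) t ht)
      (hS t ht).uniqueMDiffWithinAt
    exact congrArg (fun L : ℝ →L[ℝ] TangentSpace (𝓡 (d + 1)) (ι (γ t)) => L 1) h
  rw [hv]
  refine ⟨?_, fun h0 => ?_⟩
  · rw [hiso]
    exact (hγ.2 t ht).1.1
  · have h1 := (hγ.2 t ht).2
    rw [← hiso, h0, map_zero] at h1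
    exact lt_irrefl _ h1

theorem isC1Subdivision_one {γ : ℝ → M} (hγ : ContMDiffOn 𝓘(ℝ) (𝓡 (d + 1)) 1 γ (Icc 0 1)) :
    IsC1Subdivision d γ 0 1 1 (fun i => (i : ℝ)) := by
  refine ⟨Nat.cast_zero, Nat.cast_one, fun i hi => ?_⟩
  obtain rfl : i = 0 := by omega
  simpa using hγ

theorem isPiecewiseParallelFrame_one {g : LorentzianMetric d M} {γ : ℝ → M}
    (hγ : ContMDiffOn 𝓘(ℝ) (𝓡 (d + 1)) 1 γ (Icc 0 1)) {E : FrameAlong d γ}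
    (hE : g.IsParallelFrame γ (Icc 0 1) E) : g.IsPiecewiseParallelFrame γ 0 1 E := by
  refine ⟨1, fun i => (i : ℝ), isC1Subdivision_one hγ, fun i hi => ?_⟩
  obtain rfl : i = 0 := by omega
  simpa using hE

/-- The comparison matrix of an orthonormal family at `x'` with an orthonormal basis at `x`, when
`x = x'`: it is Lorentzian, and its entries are controlled by the coordinate components. -/
theorem exists_lorentz_comparison {g : LorentzianMetric d M}
    {e : OpenPartialHomeomorph M (Coord d)} (he : IsSmoothChart e) {x x' : M} (hx : x ∈ e.source)
    (hxx : x' = x) (b : Module.Basis (Fin (d + 1)) ℝ (TangentSpace (𝓡 (d + 1)) x))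
    (hb : ∀ α β, g.form x (b α) (b β) = minkowskiMatrix d α β)
    (v : Fin (d + 1) → TangentSpace (𝓡 (d + 1)) x')
    (hv : ∀ α β, g.form x' (v α) (v β) = minkowskiMatrix d α β) {K D₁ D₂ : ℝ} (hK0 : 0 ≤ K)
    (hK : ∀ u v, |g.bilin e (e x) u v| ≤ K * ‖u‖ * ‖v‖)
    (hD₁ : ∀ α, ‖inCoord e x' (v α)‖ ≤ D₁) (hD₂ : ∀ α, ‖inCoord e x (b α)‖ ≤ D₂) :
    ∃ L : Matrix (Fin (d + 1)) (Fin (d + 1)) ℝ, IsLorentzMatrix d L ∧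
      (∀ α β, |L α β| ≤ K * D₂ * D₁) ∧
      ∀ α, (⟨x', v α⟩ : TangentBundle (𝓡 (d + 1)) M) = ⟨x, ∑ β, L α β • b β⟩ := by
  subst hxx
  refine ⟨Matrix.of fun α β => b.repr (v α) β, LorentzianMetric.isLorentzMatrix_repr b hb v hv,
    fun α β => ?_, fun α => ?_⟩
  · rw [Matrix.of_apply, LorentzianMetric.abs_repr_eq_abs_form b hb,
      LorentzianMetric.form_eq_bilin he hx]
    refine (hK _ _).trans ?_
    have h1 := hD₁ α
    have h2 := hD₂ β
    have h3 : 0 ≤ D₂ := (norm_nonneg _).trans h2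
    gcongr
  · simp only [Matrix.of_apply]
    rw [b.sum_repr]

end Comparison

end

theorem proposition5p3 {d : ℕ} {M M' : Type*}
    [TopologicalSpace M] [T2Space M] [SecondCountableTopology M]
    [ChartedSpace (Coord d) M] [IsManifold (𝓡 (d + 1)) ∞ M]
    [TopologicalSpace M'] [T2Space M'] [SecondCountableTopology M']
    [ChartedSpace (Coord d) M'] [IsManifold (𝓡 (d + 1)) ∞ M']
    (g : LorentzianMetric d M) (hg : g.IsC1)
    (T : ∀ x : M, TangentSpace (𝓡 (d + 1)) x) (hT : g.IsTimeOrientation T)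
    (hM : g.IsGloballyHyperbolic)
    (g' : LorentzianMetric d M') (ι : M → M') (hι : IsLipschitzExtension g g' ι)
    (A : Set M) (hA : g.IsCauchyHypersurface A)
    (p : M') (hp : p ∈ futureBoundary g T g' ι)
    (δ ε₀ ε₁ : ℝ) (hδ : 0 < δ) (φ : OpenPartialHomeomorph M' (Coord d))
    (f : EuclideanSpace ℝ (Fin d) → ℝ)
    (hφ : IsFutureBoundaryChart g T g' ι A p δ ε₀ ε₁ φ f)
    (γ₁ γ₂ : ℝ → M)
    (hγ₁ : g.IsFutureCausalC1Curve T γ₁ (Ico (-1) 0))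
    (hγ₂ : g.IsFutureCausalC1Curve T γ₂ (Ico (-1) 0))
    (hγ₁φ : MapsTo (ι ∘ γ₁) (Ico (-1) 0) (belowGraph φ f))
    (hγ₂φ : MapsTo (ι ∘ γ₂) (Ico (-1) 0) (belowGraph φ f))
    (q : M') (hq : q ∈ onGraph φ f)
    (hlim₁ : Tendsto (ι ∘ γ₁) (𝓝[<] 0) (𝓝 q))
    (hlim₂ : Tendsto (ι ∘ γ₂) (𝓝[<] 0) (𝓝 q)) :
    g'.HasFiniteGapLength (ι ∘ γ₁) (Ico (-1) 0) ∧
    g'.HasFiniteGapLength (ι ∘ γ₂) (Ico (-1) 0) ∧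
    ∃ (s t : ℕ → ℝ) (σ : ℕ → ℝ → M'),
      (∀ n, s n ∈ Ico (-1 : ℝ) 0) ∧ (∀ n, t n ∈ Ico (-1 : ℝ) 0) ∧
      Tendsto s atTop (𝓝 0) ∧ Tendsto t atTop (𝓝 0) ∧
      (∀ n, IsPiecewiseC1 d (σ n) 0 1 ∧ MapsTo (σ n) (Icc 0 1) (belowGraph φ f) ∧
        σ n 0 = ι (γ₁ (s n)) ∧ σ n 1 = ι (γ₂ (t n))) ∧
      ∀ (e₁ : FrameAlong d (ι ∘ γ₁)) (e₂ : FrameAlong d (ι ∘ γ₂)),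
        g'.IsParallelFrame (ι ∘ γ₁) (Ico (-1) 0) e₁ →
        g'.IsParallelFrame (ι ∘ γ₂) (Ico (-1) 0) e₂ →
        ∃ E : ∀ n, FrameAlong d (σ n),
          (∀ n, g'.IsPiecewiseParallelFrame (σ n) 0 1 (E n) ∧
            ∀ α, (⟨σ n 0, E n 0 α⟩ : TangentBundle (𝓡 (d + 1)) M') =
              ⟨ι (γ₁ (s n)), e₁ (s n) α⟩) ∧
          Tendsto (fun n => gapLength d (σ n) (Icc 0 1) (E n)) atTop (𝓝 0) ∧
          ∃ (L : ℕ → Matrix (Fin (d + 1)) (Fin (d + 1)) ℝ) (C : ℝ),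
            ∀ n, IsLorentzMatrix d (L n) ∧ ‖Matrix.toEuclideanCLM (𝕜 := ℝ) (L n)‖ ≤ C ∧
              ∀ α, (⟨σ n 1, E n 1 α⟩ : TangentBundle (𝓡 (d + 1)) M') =
                ⟨ι (γ₂ (t n)), ∑ β, L n α β • e₂ (t n) β⟩ := by
  have hιs : ContMDiff (𝓡 (d + 1)) (𝓡 (d + 1)) ∞ ι := hι.embedding.contMDiff
  have hιd : ∀ x, MDifferentiableAt (𝓡 (d + 1)) (𝓡 (d + 1)) ι x := fun x =>
    (hιs x).mdifferentiableAt (by simp)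
  have he := hφ.smooth
  have hL := hι.regular
  have hbelow : ∀ x ∈ belowGraph φ f, x ∈ range ι := fun x hx =>
    image_subset_range _ _ (hφ.below_subset hx)
  have hC1 : ∀ x ∈ belowGraph φ f, ∀ e' : OpenPartialHomeomorph M' (Coord d), IsSmoothChart e' →
      x ∈ e'.source → ∀ μ ν, ContDiffAt ℝ 1 (g'.coeff e' μ ν) (e' x) := by
    intro x hx e' he' hxe' μ ν
    obtain ⟨m, rfl⟩ := hbelow x hx
    exact LorentzianMetric.contDiffAt_coeff_of_isometric hg hιs hι.isometric he' hxe' μ ν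
  have hS := uniqueDiffOn_Ico (-1 : ℝ) 0
  have hgap : ∀ γ : ℝ → M, g.IsFutureCausalC1Curve T γ (Ico (-1) 0) →
      MapsTo (ι ∘ γ) (Ico (-1) 0) (belowGraph φ f) → Tendsto (ι ∘ γ) (𝓝[<] 0) (𝓝 q) →
      g'.HasFiniteGapLength (ι ∘ γ) (Ico (-1) 0) := by
    intro γ hγ hγφ hlim
    have hγι : ContMDiffOn 𝓘(ℝ) (𝓡 (d + 1)) 1 (ι ∘ γ) (Ico (-1) 0) :=
      (hιs.of_le (by simp)).comp_contMDiffOn hγ.1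
    refine ⟨?_, fun E hE => LorentzianMetric.gapLength_lt_top hL he hγι (fun t ht => (hγφ ht).1)
      (fun t ht => isCausal_comp hιd hι.isometric hS hγ ht) hq.1 hlim hE⟩
    have h1 : (-1 : ℝ) ∈ Ico (-1 : ℝ) 0 := by norm_num
    obtain ⟨b, hb⟩ := LorentzianMetric.exists_orthonormal_bilin (g := g') he
      (φ.map_source (hγφ h1).1)
    obtain ⟨E, hE, -⟩ := LorentzianMetric.exists_parallelFrame he (convex_Ico (-1 : ℝ) 0) hS h1
      (fun B hB x₀ => exists_linearODE_Ico (by norm_num) hB x₀) hγι (fun t ht => (hγφ ht).1)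
      (fun e' he' t ht hx => hC1 _ (hγφ ht) e' he' hx) b hb
    exact ⟨E, hE⟩
  refine ⟨hgap γ₁ hγ₁ hγ₁φ hlim₁, hgap γ₂ hγ₂ hγ₂φ hlim₂, ?_⟩
  have hbounds : ∀ γ : ℝ → M, g.IsFutureCausalC1Curve T γ (Ico (-1) 0) →
      MapsTo (ι ∘ γ) (Ico (-1) 0) (belowGraph φ f) → Tendsto (ι ∘ γ) (𝓝[<] 0) (𝓝 q) →
      ∃ s₀ ∈ Ico (-1 : ℝ) 0, ∀ E : FrameAlong d (ι ∘ γ),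
        g'.IsParallelFrame (ι ∘ γ) (Ico (-1) 0) E →
        ∃ D, ∀ t ∈ Ico s₀ 0, ∀ α, ‖inCoord φ (ι (γ t)) (E t α)‖ ≤ D := by
    intro γ hγ hγφ hlim
    obtain ⟨s₀, hs₀, -, -, hD⟩ := LorentzianMetric.exists_bounds_near_end hL he
      ((hιs.of_le (by simp)).comp_contMDiffOn hγ.1) (fun t ht => (hγφ ht).1)
      (fun t ht => isCausal_comp hιd hι.isometric hS hγ ht) hq.1 hlim
    exact ⟨s₀, hs₀, hD⟩
  obtain ⟨a₁, ha₁, hD₁⟩ := hbounds γ₁ hγ₁ hγ₁φ hlim₁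
  obtain ⟨a₂, ha₂, hD₂⟩ := hbounds γ₂ hγ₂ hγ₂φ hlim₂
  -- A ball around the common end point on which the metric and the connection are bounded.
  obtain ⟨K₁', hK₁'⟩ := LorentzianMetric.exists_eventually_abs_bilin_le hL he (φ.map_source hq.1)
  obtain ⟨K₂', hK₂'⟩ :=
    LorentzianMetric.exists_eventually_norm_christoffelMap_le hL he (φ.map_source hq.1)
  obtain ⟨R, hR, hball⟩ := Metric.eventually_nhds_iff_ball.1
    ((φ.open_target.eventually_mem (φ.map_source hq.1)).and (hK₁'.and hK₂'))
  set K₁ := max K₁' 0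
  have hK₁0 : 0 ≤ K₁ := le_max_right _ _
  have hK₁ : ∀ y ∈ Metric.ball (φ q) R, ∀ u v, |g'.bilin φ y u v| ≤ K₁ * ‖u‖ * ‖v‖ :=
    fun y hy u v => ((hball y hy).2.1 u v).trans (by have := le_max_left K₁' 0; gcongr)
  set K₂ := max K₂' 0
  have hK₂0 : 0 ≤ K₂ := le_max_right _ _
  have hK₂ : ∀ y ∈ Metric.ball (φ q) R, ∀ u v,
      ‖g'.christoffelMap φ y u v‖ ≤ K₂ * ‖u‖ * ‖v‖ :=
    fun y hy u v => ((hball y hy).2.2 u v).trans (by have := le_max_left K₂' 0; gcongr)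
  obtain ⟨C, hC⟩ := hφ.lipschitz
  have hC0 : (0 : ℝ) ≤ C := C.2
  -- Points within `ρ` of the end point are joined by curves that stay in the ball.
  set ρ : ℝ := R / (2 * (1 + 4 * C))
  have hρ : 0 < ρ := by positivity
  have hρR : (1 + 4 * C) * ρ < R := by
    have : (1 + 4 * C) * ρ = R / 2 := by
      simp only [ρ]
      field_simp
    linarith
  set r : ℕ → ℝ := fun n => ρ * (1 / (n + 1))
  have hr0 : ∀ n, 0 < r n := fun n => mul_pos hρ Nat.one_div_pos_of_nat
  have hrρ : ∀ n, r n ≤ ρ := fun n => by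
    refine mul_le_of_le_one_right hρ.le ?_
    rw [div_le_one (by positivity)]
    linarith [(Nat.cast_nonneg n : (0 : ℝ) ≤ n)]
  have hrlim : Tendsto r atTop (𝓝 0) := by
    have h := (tendsto_one_div_add_atTop_nhds_zero_nat (𝕜 := ℝ)).const_mul ρ
    rwa [mul_zero] at h
  have htimes : ∀ γ : ℝ → M, ∀ a ∈ Ico (-1 : ℝ) 0, Tendsto (ι ∘ γ) (𝓝[<] 0) (𝓝 q) →
      ∃ s : ℕ → ℝ, (∀ n, s n ∈ Ico a 0) ∧ Tendsto s atTop (𝓝 0) ∧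
        ∀ n, ‖φ (ι (γ (s n))) - φ q‖ ≤ r n := by
    intro γ a ha hlim
    have h1 : ∀ n : ℕ, ∃ s, s ∈ Ico a 0 ∧ -(1 / ((n : ℝ) + 1)) < s ∧
        ‖φ (ι (γ s)) - φ q‖ ≤ r n := by
      intro n
      have h2 : ∀ᶠ s in 𝓝[<] (0 : ℝ), ‖φ (ι (γ s)) - φ q‖ ≤ r n := by
        have h3 := ((φ.continuousAt hq.1).tendsto.comp hlim).eventually
          (Metric.closedBall_mem_nhds _ (hr0 n))
        filter_upwards [h3] with s hs
        rwa [← dist_eq_norm]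
      have h4 : ∀ᶠ s in 𝓝[<] (0 : ℝ), -(1 / ((n : ℝ) + 1)) < s :=
        nhdsWithin_le_nhds (lt_mem_nhds (neg_lt_zero.2 Nat.one_div_pos_of_nat))
      exact (Filter.Eventually.and (Ico_mem_nhdsLT ha.2) (h4.and h2)).exists
    choose s hs1 hs2 hs3 using h1
    refine ⟨s, hs1, ?_, hs3⟩
    refine tendsto_of_tendsto_of_tendsto_of_le_of_le ?_ tendsto_const_nhds (fun n => (hs2 n).le)
      fun n => (hs1 n).2.le
    simpa using (tendsto_one_div_add_atTop_nhds_zero_nat (𝕜 := ℝ)).neg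
  obtain ⟨s, hs, hslim, hsr⟩ := htimes γ₁ a₁ ha₁ hlim₁
  obtain ⟨t, ht, htlim, htr⟩ := htimes γ₂ a₂ ha₂ hlim₂
  have hs' : ∀ n, s n ∈ Ico (-1 : ℝ) 0 := fun n => Ico_subset_Ico_left ha₁.1 (hs n)
  have ht' : ∀ n, t n ∈ Ico (-1 : ℝ) 0 := fun n => Ico_subset_Ico_left ha₂.1 (ht n)
  have hVe : ∀ y ∈ φ.target, spatialPart y ∈ openCube d ε₁ := fun y hy => by
    rw [hφ.target_eq] at hy
    exact hy.2
  choose σ hσC1 hσmaps hσ0 hσ1 hσ using fun n => exists_connecting_curve he (convex_openCube d ε₁)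
    hVe hC (fun y hy => (hball y hy).1) (hγ₁φ (hs' n)) (hγ₂φ (ht' n)) (hsr n) (htr n)
    ((mul_le_mul_of_nonneg_left (hrρ n) (by positivity)).trans_lt hρR)
  refine ⟨s, t, σ, hs', ht', hslim, htlim, fun n => ⟨⟨_, _, isC1Subdivision_one (hσC1 n)⟩,
    hσmaps n, hσ0 n, hσ1 n⟩, fun e₁ e₂ he₁ he₂ => ?_⟩
  obtain ⟨D₁, hD₁⟩ := hD₁ e₁ he₁
  obtain ⟨D₂, hD₂⟩ := hD₂ e₂ he₂
  have h0 : (0 : ℝ) ∈ Icc (0 : ℝ) 1 := left_mem_Icc.2 zero_le_one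
  have h1 : (1 : ℝ) ∈ Icc (0 : ℝ) 1 := right_mem_Icc.2 zero_le_one
  have hsrc : ∀ n, ∀ τ ∈ Icc (0 : ℝ) 1, σ n τ ∈ φ.source := fun n τ hτ => (hσmaps n hτ).1
  choose E hE hE0 using fun n => LorentzianMetric.exists_parallelFrame (g := g') he
    (convex_Icc (0 : ℝ) 1) uniqueDiffOn_Icc_zero_one h0
    (fun B hB x₀ => exists_linearODE_Icc zero_le_one hB x₀) (hσC1 n) (hsrc n)
    (fun e' he' τ hτ hx => hC1 _ (hσmaps n hτ) e' he' hx)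
    (fun α => inCoord φ (ι (γ₁ (s n))) (e₁ (s n) α)) (fun α β => by
      rw [hσ0 n]
      exact (LorentzianMetric.form_eq_bilin he (hγ₁φ (hs' n)).1 _ _).symm.trans
        (he₁.1 _ (hs' n) α β))
  -- The propagated frames are bounded, uniformly along all connecting curves.
  set D : ℝ := Real.exp (K₂ * ((2 + 4 * C) * ρ)) * D₁
  have hED : ∀ n, ∀ τ ∈ Icc (0 : ℝ) 1, ∀ α, ‖inCoord φ (σ n τ) (E n τ α)‖ ≤ D := by
    intro n τ hτ α
    have h2 := LorentzianMetric.norm_inCoord_le_of_isParallel he (convex_Icc (0 : ℝ) 1)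
      Subset.rfl (hsrc n) hK₂0 (fun τ hτ => hK₂ _ (hσ n τ hτ).1)
      (h := fun τ => (2 + 4 * C) * r n * τ) (h' := fun _ => (2 + 4 * C) * r n)
      (fun τ _ => by simpa using (hasDerivWithinAt_id τ (Icc (0 : ℝ) 1)).const_mul _)
      (fun τ hτ => (hσ n τ hτ).2) ((hE n).2 α) h0 hτ hτ.1
    rw [hE0] at h2
    refine h2.trans ?_
    have h3 : (2 + 4 * (C : ℝ)) * r n * τ - (2 + 4 * C) * r n * 0 ≤ (2 + 4 * C) * ρ := by
      rw [mul_zero, sub_zero]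
      have h4 : r n * τ ≤ ρ := (mul_le_of_le_one_right (hr0 n).le hτ.2).trans (hrρ n)
      rw [mul_assoc]
      gcongr
    exact mul_le_mul (Real.exp_le_exp.2 (mul_le_mul_of_nonneg_left h3 hK₂0)) (hD₁ (s n) (hs n) α)
      (norm_nonneg _) (Real.exp_pos _).le
  refine ⟨E, fun n => ⟨isPiecewiseParallelFrame_one (hσC1 n) (hE n), fun α =>
    tangentBundle_ext he (hsrc n 0 h0) (hσ0 n) (hE0 n α)⟩, ?_, ?_⟩
  · have hle : ∀ n, gapLength d (σ n) (Icc 0 1) (E n) ≤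
        ENNReal.ofReal ((d + 1) * K₁ * D * ((2 + 4 * C) * r n)) := by
      intro n
      calc gapLength d (σ n) (Icc 0 1) (E n)
          ≤ ∫⁻ _ in Icc (0 : ℝ) 1, ENNReal.ofReal ((d + 1) * K₁ * D * ((2 + 4 * C) * r n)) := by
            refine setLIntegral_mono' measurableSet_Icc fun τ hτ => ENNReal.ofReal_le_ofReal ?_
            refine (LorentzianMetric.sqrt_sum_repr_sq_le he (hsrc n τ hτ) _ ((hE n).1 τ hτ)
              (hK₁ _ (hσ n τ hτ).1) hK₁0 (hED n τ hτ) _).trans ?_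
            have hD0 : 0 ≤ D := (norm_nonneg _).trans (hED n τ hτ 0)
            have := (hσ n τ hτ).2
            gcongr
        _ = _ := by simp
    refine tendsto_of_tendsto_of_tendsto_of_le_of_le tendsto_const_nhds ?_ (fun _ => zero_le) hle
    have h2 := (hrlim.const_mul (2 + 4 * (C : ℝ))).const_mul ((d + 1) * K₁ * D)
    rw [mul_zero, mul_zero] at h2
    simpa using ENNReal.tendsto_ofReal h2
  · obtain ⟨c, hc⟩ := exists_norm_toEuclideanCLM_le (Fin (d + 1))
    choose L hLor hLle hLeq using fun n => exists_lorentz_comparison he (hγ₂φ (ht' n)).1 (hσ1 n)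
      (e₂ (t n)) (he₂.1 _ (ht' n)) (fun α => E n 1 α) ((hE n).1 1 h1) hK₁0
      (by
        have h2 := hK₁ _ (hσ n 1 h1).1
        rw [hσ1 n] at h2
        exact h2) (hED n 1 h1) (hD₂ (t n) (ht n))
    exact ⟨L, c * (K₁ * D₂ * D), fun n => ⟨hLor n, hc _ _ (hLle n), hLeq n⟩⟩
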